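/- Let $k$ be a field, $S=k[x_1,\dots,x_n]$, and let $M\subseteq S$ be a monomial ideal minimally generated by monomials $m_1,\dots,m_r$. All complexes of multigraded free $S$-modules are finite and carry fixed multigraded bases, and all maps are multigraded. Let $\Omega$ be the simplex on the vertex set $\{1,\dots,r\}$ with (augmented) boundary map $d$; chains have coefficients in $k$, chains of dimension $i-1$ are in homological degree $i$, and the support $\mathrm{supp}(c)$ of a chain $c$ is the union of the faces occurring in it. For a monomial $\alpha$ put $A_\alpha=\{v : m_v\mid \alpha\}$; the closure $\overline{A}$ of $A\subseteq\{1,\dots,r\}$ is the intersection of all $A_\alpha\supseteq A$ with $\alpha$ in the lcm-lattice of $M$ (the set of least common multiples of subsets of $\{m_1,\dots,m_r\}$). Let $\mathbf F$ be a minimal multigraded free resolution of $S/M$, and let $A_i$ be the matrix over $k$ obtained from the matrix of $F_i\to F_{i-1}$ by setting $x_1=\dots=x_n=1$ (the frame of $\mathbf F$). *Taylor bases.* Let $\mathbf T$ be the Taylor resolution of $S/M$, with the faces of $\Omega$ as its basis. A Taylor basis of $\mathbf F$ is a family of chains of $\Omega$, indexed by the basis elements of $\mathbf F$ in each homological degree,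 obtained as follows: take a trivial complex $\mathcal E$ (a direct sum of complexes $0\to S(-m)\xrightarrow{1}S(-m)\to 0$, shifted in homological degree) and a new multigraded basis of $\mathbf T$, indexed by the basis of $\mathbf F\oplus\mathcal E$, with respect to which the multidegrees and the differential of $\mathbf T$ are those of $\mathbf F\oplus\mathcal E$; then set $x_1=\dots=x_n=1$ in those elements of the new basis of $\mathbf T$ that correspond to the basis elements of $\mathbf F$. *The construction.* Fix a scalar $\lambda\in k\setminus\{0\}$. Choose, by induction on $i$, a chain of dimension $i-1$ for every basis element of $F_i$: - $i=0$: the chain is $\lambda\emptyset$. - $i=1$: the chain of a basis element $e_j$ of $F_1$ is $\mu\{v\}$, where $m_v$ is the multidegree of $e_j$ and $\mu\in k$ is such that $d(\mu\{v\})$ is the linear combination of the chains chosen in degree $0$ with coefficients the $j$-th column of $A_1$. (If $\lambda=1$ and $F_1\to F_0$ is $(m_1\ \cdots\ m_r):S^r\to S$, the chains in degrees $0$ and $1$ are $\emptyset$ and $\{1\},\dots,\{r\}$.) - $i\ge 2$: let $g_1,\dots,g_p$ be the chains chosen in degree $i-1$ and let $(a_1,\dots,a_p)^T$ be the $j$-th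 column of $A_i$. The chain of the $j$-th basis element of $F_i$ is any $(i-1)$-dimensional chain $f$ with $$d(f)=a_1g_1+\dots+a_pg_p,\qquad \mathrm{supp}(f)\subseteq\overline{\bigcup_{a_l\ne 0}\mathrm{supp}(g_l)} .$$ **Theorem.** 1. The construction can always be carried out: for every $\lambda\neq 0$, any choices made according to these rules in all degrees below some $N\ge 0$ can be continued to choices in all degrees. 2. For every $\lambda\ne0$, the family $B$ of chains resulting from any choices made in the construction is a Taylor basis of $\mathbf F$. 3. Conversely, every Taylor basis of $\mathbf F$ is obtained by the construction for some $\lambda\ne0$ and suitable choices. -/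

import Mathlib

open MvPolynomial
open scoped Matrix

noncomputable section

/-! ## Sequences of multigraded free modules with fixed multigraded bases

Monomials of `S = k[x_1, …, x_n]` are given by their exponent vectors in `Fin n →₀ ℕ`: divisibility
is `≤` and the least common multiple is `⊔`. -/

/-- `… → F_2 → F_1 → F_0`: the free module `F_i` has the fixed basis `ι i`, the basis element `j`
has multidegree `mdeg i j`, and `mat i` is the matrix of `F_{i+1} → F_i` in the fixed bases. -/
structure BasedSequence (k : Type*) [Field k] (n : ℕ) where
  ι : ℕ → Type
  fintypeι : ∀ i, Fintype (ι i)
  decEqι : ∀ i, DecidableEq (ι i)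
  mdeg : ∀ i, ι i → (Fin n →₀ ℕ)
  mat : ∀ i, Matrix (ι i) (ι (i + 1)) (MvPolynomial (Fin n) k)

attribute [instance] BasedSequence.fintypeι BasedSequence.decEqι

variable {k : Type*} [Field k] {n r : ℕ}

/-- `p` times a basis element of multidegree `b` is zero or multigraded of multidegree `a`, that is,
`p = 0`, or `x^b` divides `x^a` and `p` is a scalar multiple of `x^(a - b)`. -/
def IsMultigradedCoeff (a b : Fin n →₀ ℕ) (p : MvPolynomial (Fin n) k) : Prop :=
  ∀ e ∈ p.support, e + b = a

namespace BasedSequence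

/-- A finite complex of multigraded free modules with multigraded differentials. -/
structure IsComplex (F : BasedSequence k n) : Prop where
  multigraded : ∀ i l j, IsMultigradedCoeff (F.mdeg (i + 1) j) (F.mdeg i l) (F.mat i l j)
  comp_eq_zero : ∀ i, F.mat i * F.mat (i + 1) = 0
  finite_length : ∃ N, ∀ i, N ≤ i → IsEmpty (F.ι i)

/-- The matrices of the frame: all variables are set equal to `1`. -/
def frame (F : BasedSequence k n) (i : ℕ) : Matrix (F.ι i) (F.ι (i + 1)) k :=
  (F.mat i).map (MvPolynomial.eval fun _ => 1)

/-- The direct sum of two sequences, with the union of the two bases. -/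
def directSum (F E : BasedSequence k n) : BasedSequence k n where
  ι i := F.ι i ⊕ E.ι i
  fintypeι _ := inferInstance
  decEqι _ := inferInstance
  mdeg i := Sum.elim (F.mdeg i) (E.mdeg i)
  mat i := Matrix.fromBlocks (F.mat i) 0 0 (E.mat i)

/-- The trivial complex that is the direct sum, over `s : Fin q`, of the short trivial complexes
`0 → S(-x^(a s)) → S(-x^(a s)) → 0` with map `1`, placed in homological degrees `t s + 1` and
`t s`. In degree `i`, `Sum.inl s` is the target generator of the summand `s`, and `Sum.inr s` is
its source generator. -/
def trivialComplex (k : Type*) [Field k] {n : ℕ} (q : ℕ) (t : Fin q → ℕ)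
    (a : Fin q → (Fin n →₀ ℕ)) : BasedSequence k n where
  ι i := {s : Fin q // t s = i} ⊕ {s : Fin q // t s + 1 = i}
  fintypeι _ := inferInstance
  decEqι _ := inferInstance
  mdeg _ := Sum.elim (fun s => a s.1) (fun s => a s.1)
  mat _ := Matrix.fromBlocks 0 (Matrix.of fun s s' => if s.1 = s'.1 then 1 else 0) 0 0

/-- `f` is a multigraded basis of the modules of `T`, with respect to which the
multidegrees and the differentials of `T` become those of `G`; in other words `f` is the basis of
`σ(T)` for a change of basis map `σ` with `σ(T) = G`. -/
def IsChangeOfBasis (T G : BasedSequence k n)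
    (f : ∀ i, Module.Basis (G.ι i) (MvPolynomial (Fin n) k) (T.ι i → MvPolynomial (Fin n) k)) :
    Prop :=
  (∀ i j A, IsMultigradedCoeff (G.mdeg i j) (T.mdeg i A) (f i j A)) ∧
    ∀ i j, T.mat i *ᵥ f (i + 1) j = ∑ l, G.mat i l j • f i l

end BasedSequence

/-- The monomial ideal generated by the monomials `x^(m 1), …, x^(m r)`. -/
def monomialIdeal (k : Type*) [Field k] {n r : ℕ} (m : Fin r → (Fin n →₀ ℕ)) :
    Ideal (MvPolynomial (Fin n) k) :=
  Ideal.span (Set.range fun v => monomial (m v) (1 : k))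

/-- `F` is a minimal (multigraded, finite) free resolution of `S/M`. -/
structure IsMinimalFreeResolution (m : Fin r → (Fin n →₀ ℕ)) (F : BasedSequence k n) : Prop where
  isComplex : F.IsComplex
  exact : ∀ i, Function.Exact (F.mat (i + 1)).mulVecLin (F.mat i).mulVecLin
  augmentation : ∃ ε : (F.ι 0 → MvPolynomial (Fin n) k) →ₗ[MvPolynomial (Fin n) k]
      (MvPolynomial (Fin n) k ⧸ monomialIdeal k m),
    (∀ j, ∃ c : k, ε (Pi.single j 1) =
      Ideal.Quotient.mk (monomialIdeal k m) (monomial (F.mdeg 0 j) c)) ∧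
    Function.Exact (F.mat 0).mulVecLin ε ∧ Function.Surjective ε
  minimal : ∀ i l j, constantCoeff (F.mat i l j) = 0

/-! ## Chains in the simplex and the Taylor resolution -/

/-- The faces of dimension `i - 1` (with `i` vertices) of the simplex on `r` vertices. -/
abbrev Face (r i : ℕ) : Type := {A : Finset (Fin r) // A.card = i}

/-- The chains of dimension `i - 1` with coefficients in `k`. -/
abbrev Chain (k : Type*) (r i : ℕ) : Type _ := Face r i → k

/-- The matrix of the (augmented) simplicial boundary map: the coefficient of `B \ {w}` in `d(B)` is
`(-1)^p` when `w` is preceded by `p` vertices of `B`. -/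
def boundaryMatrix (k : Type*) [Field k] (r i : ℕ) : Matrix (Face r i) (Face r (i + 1)) k :=
  Matrix.of fun A B =>
    ∑ w ∈ B.1, if B.1.erase w = A.1 then (-1) ^ (B.1.filter (· < w)).card else 0

/-- The boundary map `d` of the simplex. -/
def boundary {i : ℕ} (c : Chain k r (i + 1)) : Chain k r i := boundaryMatrix k r i *ᵥ c

open Classical in
/-- The support of a chain: the union of the faces that occur in it. -/
def Chain.supp {i : ℕ} (c : Chain k r i) : Finset (Fin r) :=
  (Finset.univ.filter fun A : Face r i => c A ≠ 0).biUnion Subtype.val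

/-- The multidegree of a face: the least common multiple of the generators at its vertices. -/
def faceDeg (m : Fin r → (Fin n →₀ ℕ)) (A : Finset (Fin r)) : Fin n →₀ ℕ := A.sup m

/-- The lcm-lattice. -/
def lcmLattice (m : Fin r → (Fin n →₀ ℕ)) : Set (Fin n →₀ ℕ) := Set.range (faceDeg m)

open Classical in
/-- The label `A_α` of `α`: the vertices whose generator divides `α`. -/
def label (m : Fin r → (Fin n →₀ ℕ)) (α : Fin n →₀ ℕ) : Finset (Fin r) :=
  Finset.univ.filter fun v => m v ≤ α

open Classical in
/-- The closure of a set `A` of vertices: the intersection of the labels `A_α ⊇ A`, for `α` in the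
lcm-lattice. -/
def vertexClosure (m : Fin r → (Fin n →₀ ℕ)) (A : Finset (Fin r)) : Finset (Fin r) :=
  Finset.univ.filter fun v => ∀ α ∈ lcmLattice m, A ⊆ label m α → v ∈ label m α

/-- The Taylor resolution of `S/M`, with the faces of the simplex as its basis. -/
def taylorResolution (k : Type*) [Field k] {n r : ℕ} (m : Fin r → (Fin n →₀ ℕ)) :
    BasedSequence k n where
  ι i := Face r i
  fintypeι _ := inferInstance
  decEqι _ := inferInstance
  mdeg _ A := faceDeg m A.1
  mat i := Matrix.of fun A B =>
    monomial (faceDeg m B.1 - faceDeg m A.1) (boundaryMatrix k r i A B)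

/-- `B` is a Taylor basis of `F`: for some trivial complex `E` and some change of basis map `σ` with
`σ(T) = F ⊕ E`, where `T` is the Taylor resolution, `B` consists of the dehomogenizations of those
elements of the basis `f` of `σ(T)` that correspond to the basis of `F`. -/
def IsTaylorBasis (m : Fin r → (Fin n →₀ ℕ)) (F : BasedSequence k n)
    (B : ∀ i, F.ι i → Chain k r i) : Prop :=
  ∃ (q : ℕ) (t : Fin q → ℕ) (a : Fin q → (Fin n →₀ ℕ))
    (f : ∀ i, Module.Basis ((F.directSum (BasedSequence.trivialComplex k q t a)).ι i)
      (MvPolynomial (Fin n) k) ((taylorResolution k m).ι i → MvPolynomial (Fin n) k)),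
    BasedSequence.IsChangeOfBasis (taylorResolution k m)
      (F.directSum (BasedSequence.trivialComplex k q t a)) f ∧
    ∀ i (j : F.ι i) (A : Face r i), B i j A = MvPolynomial.eval (fun _ => 1) (f i (Sum.inl j) A)

/-! ## The inductive construction -/

/-- The chain `∑_l a_l g_l`, where `a` is the column `j` of the frame matrix of `F_{i+1} → F_i` and
the `g_l` are the chains already chosen in homological degree `i`. -/
def frameCycle (F : BasedSequence k n) (B : ∀ i, F.ι i → Chain k r i) (i : ℕ) (j : F.ι (i + 1)) :
    Chain k r i :=
  ∑ l, F.frame i l j • B i l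

open Classical in
/-- The union of the supports of the `g_l` for which `a_l ≠ 0`, in the notation above. -/
def frameSupport (F : BasedSequence k n) (B : ∀ i, F.ι i → Chain k r i) (i : ℕ)
    (j : F.ι (i + 1)) : Finset (Fin r) :=
  (Finset.univ.filter fun l => F.frame i l j ≠ 0).biUnion fun l => (B i l).supp

/-- The chains of `B` in homological degree `i` are an admissible choice for the construction, given
those in degree `i - 1`.
* Degree `0`: the chosen chain is `c ∅`, where `c` is a scalar fixed in advance.
* Degree `1`: the chain at a basis element of `F_1` is a multiple of the vertex whose
  generator is the multidegree of that element; the multiple is prescribed by the frame.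
  (If `c = 1` and `F_1 → F_0` is `(m_1 ⋯ m_r)`, the choices are `∅` and `{1}, …, {r}`.)
* Degree `i ≥ 2`: the chain at `j` fills the cycle `∑_l a_l g_l` inside the simplex on the closure
  of the union of the supports of the `g_l` with `a_l ≠ 0`. -/
def IsAdmissibleStep (m : Fin r → (Fin n →₀ ℕ)) (F : BasedSequence k n) (c : k)
    (B : ∀ i, F.ι i → Chain k r i) : ℕ → Prop
  | 0 => ∀ j, B 0 j = fun _ => c
  | 1 => ∀ j, (∃ v, F.mdeg 1 j = m v ∧ ∃ b : k, B 1 j = b • Pi.single ⟨{v}, by simp⟩ 1) ∧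
      boundary (B 1 j) = frameCycle F B 0 j
  | i + 2 => ∀ j, boundary (B (i + 2) j) = frameCycle F B (i + 1) j ∧
      (B (i + 2) j).supp ⊆ vertexClosure m (frameSupport F B (i + 1) j)

end

/-! Setting all variables to 1 turns a multigraded free module into a vector space whose basis
elements carry degrees. Its strand in multidegree `α` becomes the span of the basis elements of
degree at most `α` (`SupportedBelow`), a multigraded map becomes a filtered matrix (`IsFiltered`),
and reduction modulo the variables keeps only the entries between equal degrees (`diagPart`). The
argument takes place in this filtered linear algebra over `k`; `homogenize` and `gradedComponent`
translate back and forth.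

The construction never stops: the chain to be filled is a cycle because the frame is a complex, its
faces lie in the prescribed closure, and the full simplex on a vertex set is acyclic
(`exists_boundary_eq`, by coning).

Outcomes are Taylor bases: the chosen chains form a filtered chain map from the frame of `F` to the
chains of the simplex. Both sides resolve `S/M`, and since `λ ≠ 0` the mapping cone is exact in
every strand. An exact filtered complex has a filtered contraction, and its degree-preserving part
contracts the cone modulo the variables (`graded_quasiIso`). By minimality the differential of `F`
vanishes there, so the chains represent a basis of the homology of the Taylor complex modulo the
variables. Adding faces whose reduced boundaries form a basis of the reduced boundaries, together
with the full boundaries of these faces, gives a basis modulo the variables. Graded Nakayama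
(`exists_homogenized_basis`) lifts it to a basis of the Taylor resolution, and each added face with
its boundary spans a short trivial complex.

Taylor bases are outcomes: the boundary equations follow by setting the variables to 1. For the
supports, suppose the cycle bounded by a basis chain of multidegree `β` lives in degree `α`. It has
a filling in degree at most `α`, which differs from the basis chain by a boundary. Coordinates of
boundaries at basis elements of `F` have no constant term, so the basis element is not a proper
monomial multiple modulo boundaries, and hence `β ≤ α` (`mdeg_le_of_boundary_eq`). Every label
containing the earlier supports therefore contains the new one. -/

noncomputable section

variable {k : Type*} [Field k] {n r : ℕ}

/-! ## Filtered matrices -/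

section Filtered

variable {P : Type*} [PartialOrder P]
variable {ι κ μ : Type*}

/-- The vector `x` only involves basis elements of degree at most `α`. -/
def SupportedBelow (deg : ι → P) (α : P) (x : ι → k) : Prop := ∀ j, x j ≠ 0 → deg j ≤ α

/-- The matrix `M` does not raise degrees. -/
def IsFiltered (a : κ → P) (b : ι → P) (M : Matrix κ ι k) : Prop := ∀ l j, M l j ≠ 0 → a l ≤ b j

/-- The degree preserving part of a matrix. -/
def diagPart [DecidableEq P] (a : κ → P) (b : ι → P) (M : Matrix κ ι k) : Matrix κ ι k :=
  Matrix.of fun l j => if a l = b j then M l j else 0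

lemma SupportedBelow.mono {deg : ι → P} {α β : P} {x : ι → k} (h : SupportedBelow deg α x)
    (hαβ : α ≤ β) : SupportedBelow deg β x := fun j hj => (h j hj).trans hαβ

lemma SupportedBelow.add {deg : ι → P} {α : P} {x y : ι → k} (hx : SupportedBelow deg α x)
    (hy : SupportedBelow deg α y) : SupportedBelow deg α (x + y) := by
  intro j hj
  by_cases h : x j = 0
  · exact hy j fun h' => hj (by simp [h, h'])
  · exact hx j h

lemma SupportedBelow.smul {deg : ι → P} {α : P} {x : ι → k} (hx : SupportedBelow deg α x)
    (c : k) : SupportedBelow deg α (c • x) := by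
  intro j hj
  exact hx j fun h => hj (by simp [h])

lemma SupportedBelow.neg {deg : ι → P} {α : P} {x : ι → k} (hx : SupportedBelow deg α x) :
    SupportedBelow deg α (-x) := by
  intro j hj
  exact hx j fun h => hj (by simp [h])

lemma SupportedBelow.sub {deg : ι → P} {α : P} {x y : ι → k} (hx : SupportedBelow deg α x)
    (hy : SupportedBelow deg α y) : SupportedBelow deg α (x - y) := by
  rw [sub_eq_add_neg]
  exact hx.add hy.neg

lemma supportedBelow_single [DecidableEq ι] (deg : ι → P) (j : ι) (c : k) :
    SupportedBelow deg (deg j) (Pi.single j c) := by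
  intro l hl
  rcases eq_or_ne l j with rfl | h
  · exact le_rfl
  · exact absurd (Pi.single_eq_of_ne (M := fun _ : ι => k) h c) hl

lemma IsFiltered.supportedBelow_col {a : κ → P} {b : ι → P} {M : Matrix κ ι k}
    (hM : IsFiltered a b M) (j : ι) : SupportedBelow a (b j) (M.col j) := fun l hl => hM l j hl

lemma IsFiltered.mulVec [Fintype ι] {a : κ → P} {b : ι → P} {M : Matrix κ ι k} {α : P} {x : ι → k}
    (hM : IsFiltered a b M) (hx : SupportedBelow b α x) : SupportedBelow a α (M *ᵥ x) := by
  intro l hl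
  obtain ⟨j, -, hj⟩ := Finset.exists_ne_zero_of_sum_ne_zero hl
  exact (hM l j (left_ne_zero_of_mul hj)).trans (hx j (right_ne_zero_of_mul hj))

/-- In a nonzero term of the product the middle degree lies between the outer two, so equal outer
degrees force all three to agree. Passage to the associated graded is thus multiplicative. -/
lemma diagPart_mul [DecidableEq P] [Fintype ι] {a : κ → P} {b : ι → P} {c : μ → P} {M : Matrix κ ι k}
    {N : Matrix ι μ k} (hM : IsFiltered a b M) (hN : IsFiltered b c N) :
    diagPart a c (M * N) = diagPart a b M * diagPart b c N := by
  ext l j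
  simp only [diagPart, Matrix.mul_apply, Matrix.of_apply]
  split_ifs with h
  · refine Finset.sum_congr rfl fun x _ => ?_
    by_cases h0 : M l x = 0
    · simp [h0]
    by_cases h1 : N x j = 0
    · simp [h1]
    have h2 : a l = b x := le_antisymm (hM l x h0) (h ▸ hN x j h1)
    rw [if_pos h2, if_pos (h2 ▸ h)]
  · refine (Finset.sum_eq_zero fun x _ => ?_).symm
    split_ifs with h1 h2
    · exact absurd (h1.trans h2) h
    all_goals simp

lemma diagPart_add {P : Type*} [DecidableEq P] (a : κ → P) (b : ι → P) (M N : Matrix κ ι k) :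
    diagPart a b (M + N) = diagPart a b M + diagPart a b N := by
  ext l j
  simp only [diagPart, Matrix.of_apply, Matrix.add_apply]
  split_ifs <;> simp

lemma diagPart_zero {P : Type*} [DecidableEq P] (a : κ → P) (b : ι → P) : diagPart a b (0 : Matrix κ ι k) = 0 := by
  ext l j
  simp [diagPart]

lemma diagPart_one {P : Type*} [DecidableEq P] [DecidableEq ι] (a : ι → P) : diagPart a a (1 : Matrix ι ι k) = 1 := by
  ext l j
  by_cases h : l = j
  · subst h
    simp [diagPart]
  · simp [diagPart, Matrix.one_apply_ne h]

lemma diagPart_mulVec_mulVec [DecidableEq P] [Fintype ι] [Fintype μ] {a : κ → P} {b : ι → P} {c : μ → P}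
    {M : Matrix κ ι k} {N : Matrix ι μ k} (hM : IsFiltered a b M) (hN : IsFiltered b c N)
    (x : μ → k) :
    diagPart a b M *ᵥ (diagPart b c N *ᵥ x) = diagPart a c (M * N) *ᵥ x := by
  rw [Matrix.mulVec_mulVec, diagPart_mul hM hN]

/-- A filtered factorization through `D` can be chosen column by column. -/
lemma exists_filtered_factor [Fintype ι] {b : ι → P} {c : μ → P} (D : Matrix κ ι k)
    (M : Matrix κ μ k) (h : ∀ j, ∃ y, SupportedBelow b (c j) y ∧ D *ᵥ y = M.col j) :
    ∃ s : Matrix ι μ k, IsFiltered b c s ∧ D * s = M := by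
  choose y hy hDy using h
  refine ⟨Matrix.of fun l j => y j l, fun l j hl => hy j l hl, ?_⟩
  ext l j
  exact congrFun (hDy j) l

/-- An exact filtered complex has a filtered contracting homotopy. -/
lemma exists_filtered_contraction {ι : ℕ → Type*} [∀ i, Fintype (ι i)] [∀ i, DecidableEq (ι i)]
    (deg : ∀ i, ι i → P) (D : ∀ i, Matrix (ι i) (ι (i + 1)) k)
    (hD : ∀ i, IsFiltered (deg i) (deg (i + 1)) (D i))
    (surj : ∀ α x, SupportedBelow (deg 0) α x → ∃ y, SupportedBelow (deg 1) α y ∧ D 0 *ᵥ y = x)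
    (exact : ∀ i α x, SupportedBelow (deg (i + 1)) α x → D i *ᵥ x = 0 →
      ∃ y, SupportedBelow (deg (i + 2)) α y ∧ D (i + 1) *ᵥ y = x)
    (hDD : ∀ i, D i * D (i + 1) = 0) :
    ∃ s : ∀ i, Matrix (ι (i + 1)) (ι i) k, (∀ i, IsFiltered (deg (i + 1)) (deg i) (s i)) ∧
      D 0 * s 0 = 1 ∧ ∀ i, D (i + 1) * s (i + 1) + s i * D i = 1 := by
  obtain ⟨s₀, hs₀, hDs₀⟩ : ∃ s : Matrix (ι 1) (ι 0) k, IsFiltered (deg 1) (deg 0) s ∧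
      D 0 * s = 1 := by
    refine exists_filtered_factor _ _ fun j => surj _ _ ?_
    have : (1 : Matrix (ι 0) (ι 0) k).col j = Pi.single j 1 := by
      ext l; simp [Matrix.one_apply, Pi.single_apply]
    rw [this]
    exact supportedBelow_single _ j 1
  -- The columns of `1 - s * D i` are cycles, and filling them gives the next homotopy. The weaker
  -- identity `D i * s * D i = D i` is what makes them cycles and is all the induction has to carry.
  have step : ∀ i (s : Matrix (ι (i + 1)) (ι i) k), IsFiltered (deg (i + 1)) (deg i) s →
      D i * s * D i = D i → ∃ s' : Matrix (ι (i + 2)) (ι (i + 1)) k,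
        IsFiltered (deg (i + 2)) (deg (i + 1)) s' ∧ D (i + 1) * s' + s * D i = 1 := by
    intro i s hs hDs
    obtain ⟨s', hs', h⟩ := exists_filtered_factor (b := deg (i + 2))
      (c := deg (i + 1)) (D (i + 1)) (1 - s * D i) fun j => by
        refine exact i _ _ ?_ ?_
        · have h1 : (1 - s * D i).col j = Pi.single j 1 - s *ᵥ (D i).col j := by
            ext l; simp [Matrix.one_apply, Pi.single_apply, Matrix.mul_apply, Matrix.mulVec,
              dotProduct]
          rw [h1]
          exact (supportedBelow_single _ j 1).sub (hs.mulVec ((hD i).supportedBelow_col j))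
        · have h2 : D i *ᵥ (1 - s * D i).col j = (D i * (1 - s * D i)).col j := by
            ext l; simp [Matrix.mul_apply, Matrix.mulVec, dotProduct]
          rw [h2, Matrix.mul_sub, ← Matrix.mul_assoc, hDs, Matrix.mul_one, sub_self]
          rfl
    exact ⟨s', hs', by rw [h, sub_add_cancel]⟩
  have key : ∀ i (s : Matrix (ι (i + 1)) (ι i) k) (s' : Matrix (ι (i + 2)) (ι (i + 1)) k),
      D (i + 1) * s' + s * D i = 1 → D (i + 1) * s' * D (i + 1) = D (i + 1) := by
    intro i s s' h
    rw [eq_sub_of_add_eq h, Matrix.sub_mul, Matrix.mul_assoc, hDD, Matrix.one_mul,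
      Matrix.mul_zero, sub_zero]
  let Q : ℕ → Type _ := fun i => {s : Matrix (ι (i + 1)) (ι i) k //
    IsFiltered (deg (i + 1)) (deg i) s ∧ D i * s * D i = D i}
  let S : ∀ i, Q i := fun i => Nat.rec (motive := Q)
    ⟨s₀, hs₀, by rw [hDs₀, Matrix.one_mul]⟩
    (fun i s => ⟨(step i s.1 s.2.1 s.2.2).choose, (step i s.1 s.2.1 s.2.2).choose_spec.1,
      key i _ _ (step i s.1 s.2.1 s.2.2).choose_spec.2⟩) i
  exact ⟨fun i => (S i).1, fun i => (S i).2.1, hDs₀,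
    fun i => (step i (S i).1 (S i).2.1 (S i).2.2).choose_spec.2⟩

/-- A maximal independent set of columns of a matrix. -/
lemma exists_column_basis [Fintype ι] (M : Matrix κ ι k) : ∃ J : Set ι,
    (∀ c : ι → k, (∀ x ∉ J, c x = 0) → M *ᵥ c = 0 → c = 0) ∧
      ∀ y, ∃ c : ι → k, (∀ x ∉ J, c x = 0) ∧ M *ᵥ c = M *ᵥ y := by
  classical
  obtain ⟨J, -, -, hspan, hli⟩ := exists_linearIndepOn_extension (K := k) (v := fun j => M.col j)
    (linearIndepOn_empty k _) (Set.empty_subset Set.univ)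
  have hsum : ∀ c : ι →₀ k, Finsupp.linearCombination k (fun j => M.col j) c = M *ᵥ c := by
    intro c
    rw [Finsupp.linearCombination_apply, Finsupp.sum_fintype _ _ (by simp)]
    ext l
    simp [Matrix.mulVec, dotProduct, mul_comm]
  refine ⟨J, fun c hc hMc => ?_, fun y => ?_⟩
  · have h := linearIndepOn_iff.1 hli (Finsupp.equivFunOnFinite.symm c)
      (by
        rw [Finsupp.mem_supported']
        exact hc)
      (by rw [hsum]; exact hMc)
    exact funext fun x => DFunLike.congr_fun h x
  · have hy : M *ᵥ y ∈ Submodule.span k ((fun j => M.col j) '' J) := by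
      have h1 : Submodule.span k (Set.range fun j => M.col j) ≤
          Submodule.span k ((fun j => M.col j) '' J) := by
        rw [Submodule.span_le, ← Set.image_univ]
        exact hspan
      refine h1 ?_
      rw [← Matrix.range_mulVecLin]
      exact ⟨y, rfl⟩
    rw [Finsupp.mem_span_image_iff_linearCombination] at hy
    obtain ⟨c, hc, h⟩ := hy
    exact ⟨c, (Finsupp.mem_supported' k c).1 hc, by rw [← h, hsum]⟩

end Filtered

/-! ## The simplex -/

section Simplex

/-- The sign `(-1)^p`, where `p` is the number of elements of `A` preceding `w`. -/
def faceSign (k : Type*) [Field k] {r : ℕ} (w : Fin r) (A : Finset (Fin r)) : k :=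
  (-1) ^ (A.filter (· < w)).card

lemma faceSign_mul_self (w : Fin r) (A : Finset (Fin r)) :
    faceSign k w A * faceSign k w A = 1 := by
  rw [faceSign, ← mul_pow]
  simp

lemma faceSign_insert_self (w : Fin r) (A : Finset (Fin r)) :
    faceSign k w (insert w A) = faceSign k w A := by
  simp [faceSign, Finset.filter_insert]

/-- Exactly one of two distinct vertices precedes the other, so only one of the two sign comparisons
picks up a factor `-1`. This drives both the vanishing of the squared boundary and the cone formula.
-/
lemma faceSign_swap {v w : Fin r} (hvw : v ≠ w) {A : Finset (Fin r)} (hv : v ∉ A) (hw : w ∉ A) :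
    faceSign k w A * faceSign k v (insert w A) = - (faceSign k v A * faceSign k w (insert v A)) := by
  rcases lt_or_gt_of_ne hvw with h | h
  · simp [faceSign, Finset.filter_insert, h, h.not_gt, hv, pow_succ]
    ring
  · simp [faceSign, Finset.filter_insert, h, h.not_gt, hw, pow_succ]
    ring

/-- The boundary of a function on all subsets of the vertex set. -/
def fullBoundary (c : Finset (Fin r) → k) (A : Finset (Fin r)) : k :=
  ∑ w ∈ Aᶜ, faceSign k w A * c (insert w A)

/-- The cone over a function on subsets of the vertex set. -/
def fullCone (v : Fin r) (c : Finset (Fin r) → k) (A : Finset (Fin r)) : k :=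
  if v ∈ A then faceSign k v A * c (A.erase v) else 0

lemma fullBoundary_fullBoundary (c : Finset (Fin r) → k) (A : Finset (Fin r)) :
    fullBoundary (fullBoundary c) A = 0 := by
  simp only [fullBoundary, Finset.mul_sum]
  rw [Finset.sum_sigma']
  refine Finset.sum_involution (fun x _ => ⟨x.2, x.1⟩) ?_ ?_ ?_ ?_
  · rintro ⟨w, u⟩ h
    simp only [Finset.mem_sigma, Finset.mem_compl, Finset.mem_insert, not_or] at h
    obtain ⟨h1, h2, h3⟩ := h
    have := faceSign_swap (k := k) h2 h3 h1
    simp only [Finset.insert_comm u w, ← mul_assoc, this]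
    ring
  · rintro ⟨w, u⟩ h - h'
    simp only [Finset.mem_sigma, Finset.mem_compl, Finset.mem_insert, not_or] at h
    simp only [Sigma.mk.injEq] at h'
    exact h.2.1 h'.1
  · rintro ⟨w, u⟩ h
    simp only [Finset.mem_sigma, Finset.mem_compl, Finset.mem_insert, not_or] at h ⊢
    exact ⟨h.2.2, Ne.symm h.2.1, h.1⟩
  · rintro ⟨w, u⟩ h
    rfl

/-- Coning from `v` is a contracting homotopy of the augmented simplex, which is the source of all
acyclicity on the Taylor side. -/
lemma fullBoundary_fullCone (v : Fin r) (c : Finset (Fin r) → k) (A : Finset (Fin r)) :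
    fullBoundary (fullCone v c) A + fullCone v (fullBoundary c) A = c A := by
  by_cases hv : v ∈ A
  · obtain ⟨A, hvA, rfl⟩ : ∃ A', v ∉ A' ∧ A = insert v A' :=
      ⟨A.erase v, Finset.notMem_erase v A, (Finset.insert_erase hv).symm⟩
    have h1 : Aᶜ = insert v (insert v A)ᶜ := by
      ext w
      simp only [Finset.mem_compl, Finset.mem_insert, not_or]
      by_cases h : w = v <;> simp [h, hvA]
    simp only [fullCone, if_pos hv, Finset.erase_insert hvA, fullBoundary]
    rw [h1, Finset.sum_insert (by simp), mul_add, ← mul_assoc, faceSign_insert_self,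
      faceSign_mul_self, one_mul, add_left_comm, add_eq_left, Finset.mul_sum,
      ← Finset.sum_add_distrib]
    refine Finset.sum_eq_zero fun w hw => ?_
    simp only [Finset.mem_compl, Finset.mem_insert, not_or] at hw
    have h2 : (insert w (insert v A)).erase v = insert w A := by
      rw [Finset.insert_comm, Finset.erase_insert]
      simp [hvA, Ne.symm hw.1]
    have h3 : faceSign k v (insert w (insert v A)) = faceSign k v (insert w A) := by
      rw [Finset.insert_comm, faceSign_insert_self]
    have h4 := faceSign_swap (k := k) (Ne.symm hw.1) hvA hw.2
    have e1 := faceSign_mul_self (k := k) w A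
    have e2 := faceSign_mul_self (k := k) w (insert v A)
    rw [if_pos (by simp), h2, h3, ← mul_assoc, ← mul_assoc, ← add_mul]
    refine mul_eq_zero_of_left ?_ _
    -- The swap identity is multiplied by two signs, whose squares are then replaced by 1.
    linear_combination faceSign k w A * faceSign k w (insert v A) * h4 -
      faceSign k w (insert v A) * faceSign k v (insert w A) * e1 -
      faceSign k v A * faceSign k w A * e2
  · simp only [fullCone, if_neg hv, add_zero, fullBoundary]
    rw [Finset.sum_eq_single v]
    · rw [if_pos (by simp), Finset.erase_insert hv, faceSign_insert_self, ← mul_assoc,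
        faceSign_mul_self, one_mul]
    · intro w _ hwv
      rw [if_neg (by simp [hv, Ne.symm hwv]), mul_zero]
    · simp [hv]

/-- Extension of a chain by zero to all subsets of the vertex set. -/
def Chain.extend {i : ℕ} (c : Chain k r i) (A : Finset (Fin r)) : k :=
  if h : A.card = i then c ⟨A, h⟩ else 0

lemma Chain.extend_coe {i : ℕ} (c : Chain k r i) (A : Face r i) : c.extend A.1 = c A := by
  simp [Chain.extend, A.2]

lemma boundary_apply {i : ℕ} (c : Chain k r (i + 1)) (A : Face r i) :
    boundary c A = fullBoundary c.extend A.1 := by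
  have h : ∀ B : Face r (i + 1), boundaryMatrix k r i A B * c B =
      ∑ w ∈ A.1ᶜ, if insert w A.1 = B.1 then faceSign k w A.1 * c B else 0 := by
    intro B
    have h1 : B.1.filter (fun w => B.1.erase w = A.1) =
        A.1ᶜ.filter (fun w => insert w A.1 = B.1) := by
      ext w
      simp only [Finset.mem_filter, Finset.mem_compl]
      constructor
      · rintro ⟨h1, h2⟩
        rw [← h2]
        exact ⟨Finset.notMem_erase _ _, Finset.insert_erase h1⟩
      · rintro ⟨h1, h2⟩
        rw [← h2]
        exact ⟨Finset.mem_insert_self _ _, Finset.erase_insert h1⟩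
    rw [boundaryMatrix, Matrix.of_apply, ← Finset.sum_filter, ← Finset.sum_filter, h1,
      Finset.sum_mul]
    refine Finset.sum_congr rfl fun w hw => ?_
    rw [← (Finset.mem_filter.1 hw).2]
    congr 1
    exact faceSign_insert_self w A.1
  simp only [boundary, Matrix.mulVec, dotProduct, h]
  rw [Finset.sum_comm]
  refine Finset.sum_congr rfl fun w hw => ?_
  have hw' : (insert w A.1).card = i + 1 := by
    rw [Finset.card_insert_of_notMem (by simpa using hw), A.2]
  rw [Finset.sum_eq_single ⟨insert w A.1, hw'⟩]
  · simp [Chain.extend, hw']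
  · intro B _ hB
    rw [if_neg fun h => hB (Subtype.ext h.symm)]
  · simp

lemma extend_boundary {i : ℕ} (c : Chain k r (i + 1)) :
    (boundary c).extend = fullBoundary c.extend := by
  ext A
  by_cases hA : A.card = i
  · simp only [Chain.extend, dif_pos hA, boundary_apply]
  · rw [Chain.extend, dif_neg hA, fullBoundary]
    refine (Finset.sum_eq_zero fun w hw => ?_).symm
    rw [Chain.extend, dif_neg, mul_zero]
    rw [Finset.card_insert_of_notMem (by simpa using hw)]
    omega

lemma boundary_boundary {i : ℕ} (c : Chain k r (i + 2)) : boundary (boundary c) = 0 := by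
  ext A
  rw [boundary_apply, extend_boundary, fullBoundary_fullBoundary]
  rfl

lemma boundaryMatrix_mul (i : ℕ) : boundaryMatrix k r i * boundaryMatrix k r (i + 1) = 0 := by
  refine Matrix.ext_of_mulVec_single fun j => ?_
  rw [← Matrix.mulVec_mulVec, Matrix.zero_mulVec]
  exact boundary_boundary _

/-- A cycle whose faces all lie in `W` is the boundary of a chain whose faces all lie in `W`. -/
lemma exists_boundary_eq {i : ℕ} (W : Finset (Fin r)) (z : Chain k r (i + 1))
    (hz : ∀ A, z A ≠ 0 → A.1 ⊆ W) (hdz : boundary z = 0) :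
    ∃ y : Chain k r (i + 2), (∀ A, y A ≠ 0 → A.1 ⊆ W) ∧ boundary y = z := by
  by_cases h0 : z = 0
  · exact ⟨0, by simp, by simp [boundary, h0]⟩
  -- A nonzero chain supplies an apex inside `W`; the zero chain is treated apart because `W` may be
  -- empty.
  obtain ⟨A₀, hA₀⟩ := Function.ne_iff.1 h0
  obtain ⟨v, hv⟩ : A₀.1.Nonempty := by
    rw [← Finset.card_pos, A₀.2]
    omega
  have hvW := hz A₀ hA₀ hv
  let y : Chain k r (i + 2) := fun A => fullCone v z.extend A.1
  have hy : y.extend = fullCone v z.extend := by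
    ext A
    by_cases hA : A.card = i + 2
    · simp only [Chain.extend, dif_pos hA, y]
    · rw [Chain.extend, dif_neg hA, fullCone]
      split_ifs with hvA
      · rw [Chain.extend, dif_neg, mul_zero]
        rw [Finset.card_erase_of_mem hvA]
        omega
      · rfl
  refine ⟨y, fun A hA => ?_, ?_⟩
  · simp only [y, fullCone] at hA
    split_ifs at hA with hvA
    · have h1 := right_ne_zero_of_mul hA
      rw [Chain.extend] at h1
      split_ifs at h1 with h2
      · rw [← Finset.insert_erase hvA]
        exact Finset.insert_subset hvW (hz _ h1)
      · exact absurd rfl h1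
    · exact absurd rfl hA
  · ext A
    have h1 := fullBoundary_fullCone v z.extend A.1
    rw [← extend_boundary, hdz] at h1
    rw [boundary_apply, hy, ← Chain.extend_coe z, ← h1]
    simp [fullCone, Chain.extend]

lemma Chain.subset_supp {i : ℕ} {c : Chain k r i} {A : Face r i} (h : c A ≠ 0) :
    A.1 ⊆ c.supp := by
  classical
  intro v hv
  simp only [Chain.supp, Finset.mem_biUnion, Finset.mem_filter, Finset.mem_univ, true_and]
  exact ⟨A, h, hv⟩

lemma Chain.supp_subset_iff {i : ℕ} {c : Chain k r i} {W : Finset (Fin r)} :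
    c.supp ⊆ W ↔ ∀ A, c A ≠ 0 → A.1 ⊆ W := by
  classical
  refine ⟨fun h A hA => (Chain.subset_supp hA).trans h, fun h => ?_⟩
  rw [Chain.supp, Finset.biUnion_subset]
  intro A hA
  exact h A (Finset.mem_filter.1 hA).2

/-! ### Labels and closures -/

lemma mem_label {m : Fin r → (Fin n →₀ ℕ)} {α : Fin n →₀ ℕ} {v : Fin r} :
    v ∈ label m α ↔ m v ≤ α := by
  simp [label]

lemma faceDeg_le_iff {m : Fin r → (Fin n →₀ ℕ)} {α : Fin n →₀ ℕ} {A : Finset (Fin r)} :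
    faceDeg m A ≤ α ↔ A ⊆ label m α := by
  simp [faceDeg, Finset.subset_iff, mem_label]

/-- The multidegrees of the faces of dimension `i - 1`. -/
abbrev chainDeg (m : Fin r → (Fin n →₀ ℕ)) (i : ℕ) (A : Face r i) : Fin n →₀ ℕ := faceDeg m A.1

lemma supportedBelow_chainDeg_iff {m : Fin r → (Fin n →₀ ℕ)} {α : Fin n →₀ ℕ} {i : ℕ}
    {c : Chain k r i} : SupportedBelow (chainDeg m i) α c ↔ c.supp ⊆ label m α := by
  simp only [SupportedBelow, Chain.supp_subset_iff, faceDeg_le_iff]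

lemma subset_vertexClosure (m : Fin r → (Fin n →₀ ℕ)) (A : Finset (Fin r)) :
    A ⊆ vertexClosure m A := by
  intro v hv
  simp only [vertexClosure, Finset.mem_filter, Finset.mem_univ, true_and]
  exact fun α _ h => h hv

/-- The closure only tests elements of the lcm-lattice, whereas `α` is arbitrary. The lcm of the
generators dividing `α` has the same label and lies in the lattice. -/
lemma vertexClosure_subset_label {m : Fin r → (Fin n →₀ ℕ)} {A : Finset (Fin r)}
    {α : Fin n →₀ ℕ} (h : A ⊆ label m α) : vertexClosure m A ⊆ label m α := by
  intro v hv
  simp only [vertexClosure, Finset.mem_filter, Finset.mem_univ, true_and] at hv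
  have h1 : faceDeg m (label m α) ≤ α := faceDeg_le_iff.2 subset_rfl
  have h2 := hv (faceDeg m (label m α)) ⟨_, rfl⟩ (h.trans (faceDeg_le_iff.1 le_rfl))
  exact mem_label.2 ((mem_label.1 h2).trans h1)

lemma isFiltered_boundaryMatrix (m : Fin r → (Fin n →₀ ℕ)) (i : ℕ) :
    IsFiltered (chainDeg m i) (chainDeg m (i + 1)) (boundaryMatrix k r i) := by
  intro A B h
  obtain ⟨w, -, hw⟩ := Finset.exists_ne_zero_of_sum_ne_zero h
  have : B.1.erase w = A.1 := by
    by_contra h'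
    exact hw (if_neg h')
  rw [chainDeg, ← this]
  exact Finset.sup_mono (Finset.erase_subset _ _)

lemma exists_boundary_eq_of_supportedBelow {m : Fin r → (Fin n →₀ ℕ)} {α : Fin n →₀ ℕ} {i : ℕ}
    (z : Chain k r (i + 1)) (hz : SupportedBelow (chainDeg m (i + 1)) α z)
    (hdz : boundary z = 0) :
    ∃ y : Chain k r (i + 2), SupportedBelow (chainDeg m (i + 2)) α y ∧ boundary y = z := by
  simp only [SupportedBelow, faceDeg_le_iff] at hz ⊢
  exact exists_boundary_eq _ z hz hdz

end Simplex

/-! ## Homogenization -/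

section Homogenization

variable {ι κ : Type*}

/-- The homogenization of a vector of scalars to a vector of multidegree `α`. -/
def homogenize (deg : ι → (Fin n →₀ ℕ)) (α : Fin n →₀ ℕ) (x : ι → k) :
    ι → MvPolynomial (Fin n) k := fun j => monomial (α - deg j) (x j)

/-- The scalars in the component of multidegree `α` of a vector of polynomials. -/
def gradedComponent (deg : ι → (Fin n →₀ ℕ)) (α : Fin n →₀ ℕ) (y : ι → MvPolynomial (Fin n) k) :
    ι → k := fun j => if deg j ≤ α then coeff (α - deg j) (y j) else 0

/-- All entries of the matrix are multigraded. -/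
def IsMultigradedMatrix (a : κ → (Fin n →₀ ℕ)) (b : ι → (Fin n →₀ ℕ))
    (M : Matrix κ ι (MvPolynomial (Fin n) k)) : Prop :=
  ∀ l j, IsMultigradedCoeff (b j) (a l) (M l j)

lemma IsMultigradedCoeff.eq_monomial {a b : Fin n →₀ ℕ} {p : MvPolynomial (Fin n) k}
    (h : IsMultigradedCoeff a b p) : p = monomial (a - b) (eval (fun _ => 1) p) := by
  obtain ⟨c, hc⟩ : ∃ c, p = monomial (a - b) c := by
    refine ⟨coeff (a - b) p, ?_⟩
    ext e
    rw [coeff_monomial]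
    split_ifs with he
    · rw [he]
    · by_contra h0
      exact he (by rw [← h e (mem_support_iff.2 h0), add_tsub_cancel_right])
  rw [hc]
  simp [eval_monomial]

lemma IsMultigradedCoeff.le {a b : Fin n →₀ ℕ} {p : MvPolynomial (Fin n) k}
    (h : IsMultigradedCoeff a b p) (hp : p ≠ 0) : b ≤ a := by
  obtain ⟨e, he⟩ := Finset.nonempty_of_ne_empty (mt support_eq_empty.1 hp)
  rw [← h e he]
  exact le_add_self

lemma isMultigradedCoeff_monomial {a b : Fin n →₀ ℕ} {c : k} (h : c ≠ 0 → b ≤ a) :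
    IsMultigradedCoeff a b (monomial (a - b) c) := by
  intro e he
  classical
  rw [mem_support_iff, coeff_monomial] at he
  split_ifs at he with h1
  · rw [← h1, tsub_add_cancel_of_le (h he)]
  · exact absurd rfl he

lemma IsMultigradedMatrix.isFiltered {a : κ → (Fin n →₀ ℕ)} {b : ι → (Fin n →₀ ℕ)}
    {M : Matrix κ ι (MvPolynomial (Fin n) k)} (hM : IsMultigradedMatrix a b M) :
    IsFiltered a b (M.map (eval fun _ => 1)) := by
  intro l j h
  refine (hM l j).le fun h0 => h ?_
  simp [h0]

/-- Exponent differences telescope wherever the scalars are nonzero; elsewhere the truncated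
subtraction is multiplied by zero. -/
lemma IsMultigradedMatrix.mulVec_homogenize [Fintype ι] {a : κ → (Fin n →₀ ℕ)}
    {b : ι → (Fin n →₀ ℕ)} {M : Matrix κ ι (MvPolynomial (Fin n) k)}
    (hM : IsMultigradedMatrix a b M) {α : Fin n →₀ ℕ} {x : ι → k} (hx : SupportedBelow b α x) :
    M *ᵥ homogenize b α x = homogenize a α (M.map (eval fun _ => 1) *ᵥ x) := by
  ext1 l
  simp only [Matrix.mulVec, dotProduct, homogenize, Matrix.map_apply, map_sum]
  refine Finset.sum_congr rfl fun j _ => ?_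
  conv_lhs => rw [(hM l j).eq_monomial, monomial_mul]
  by_cases h1 : eval (fun _ => 1) (M l j) = 0
  · simp [h1]
  by_cases h2 : x j = 0
  · simp [h2]
  rw [add_comm, tsub_add_tsub_cancel (hx j h2) (hM.isFiltered l j h1)]

lemma IsMultigradedMatrix.mulVec_gradedComponent [Fintype ι] {a : κ → (Fin n →₀ ℕ)}
    {b : ι → (Fin n →₀ ℕ)} {M : Matrix κ ι (MvPolynomial (Fin n) k)}
    (hM : IsMultigradedMatrix a b M) (α : Fin n →₀ ℕ) (y : ι → MvPolynomial (Fin n) k) :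
    M.map (eval fun _ => 1) *ᵥ gradedComponent b α y = gradedComponent a α (M *ᵥ y) := by
  ext1 l
  simp only [Matrix.mulVec, dotProduct, gradedComponent, Matrix.map_apply]
  split_ifs with hl
  · rw [coeff_sum]
    refine Finset.sum_congr rfl fun j _ => ?_
    conv_rhs => rw [(hM l j).eq_monomial, coeff_monomial_mul']
    by_cases h1 : eval (fun _ => 1) (M l j) = 0
    · simp [h1]
    have h2 := hM.isFiltered l j h1
    have h3 : b j - a l ≤ α - a l ↔ b j ≤ α := tsub_le_tsub_iff_right hl
    simp only [h3]
    split_ifs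
    · rw [tsub_tsub_tsub_cancel_right h2]
    · rw [mul_zero]
  · refine Finset.sum_eq_zero fun j _ => ?_
    split_ifs with h2
    · by_cases h1 : eval (fun _ => 1) (M l j) = 0
      · simp [h1]
      · exact absurd ((hM.isFiltered l j h1).trans h2) hl
    · rw [mul_zero]

lemma supportedBelow_gradedComponent (deg : ι → (Fin n →₀ ℕ)) (α : Fin n →₀ ℕ)
    (y : ι → MvPolynomial (Fin n) k) : SupportedBelow deg α (gradedComponent deg α y) := by
  intro j hj
  by_contra h
  exact hj (if_neg h)

lemma gradedComponent_homogenize {deg : ι → (Fin n →₀ ℕ)} {α : Fin n →₀ ℕ} {x : ι → k}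
    (hx : SupportedBelow deg α x) : gradedComponent deg α (homogenize deg α x) = x := by
  ext j
  simp only [gradedComponent, homogenize, coeff_monomial]
  by_cases h : x j = 0
  · simp [h]
  · simp [hx j h]

lemma homogenize_zero (deg : ι → (Fin n →₀ ℕ)) (α : Fin n →₀ ℕ) :
    homogenize deg α (0 : ι → k) = 0 := by
  ext1 j
  simp [homogenize]

end Homogenization

/-! ### Frames of multigraded complexes -/

namespace BasedSequence

variable {F : BasedSequence k n}

lemma IsComplex.isFiltered_frame (hF : F.IsComplex) (i : ℕ) :
    IsFiltered (F.mdeg i) (F.mdeg (i + 1)) (F.frame i) :=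
  IsMultigradedMatrix.isFiltered (hF.multigraded i)

lemma IsComplex.frame_mul_frame (hF : F.IsComplex) (i : ℕ) : F.frame i * F.frame (i + 1) = 0 := by
  rw [frame, frame, ← Matrix.map_mul, hF.comp_eq_zero]
  simp

/-- Only the component of multidegree `α` of a polynomial solution matters, and its scalars solve
the frame equation with the required degree bound. -/
lemma IsComplex.exists_frame_mulVec_eq (hF : F.IsComplex) {i : ℕ} {α : Fin n →₀ ℕ}
    {x : F.ι i → k} (hx : SupportedBelow (F.mdeg i) α x)
    (h : ∃ y, F.mat i *ᵥ y = homogenize (F.mdeg i) α x) :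
    ∃ y, SupportedBelow (F.mdeg (i + 1)) α y ∧ F.frame i *ᵥ y = x := by
  obtain ⟨y, hy⟩ := h
  refine ⟨gradedComponent (F.mdeg (i + 1)) α y, supportedBelow_gradedComponent _ _ _, ?_⟩
  have := IsMultigradedMatrix.mulVec_gradedComponent (hF.multigraded i) α y
  rw [frame, this, hy, gradedComponent_homogenize hx]

end BasedSequence

/-! ### Consequences of minimality and exactness of the resolution -/

section MinimalResolution

variable {m : Fin r → (Fin n →₀ ℕ)} {F : BasedSequence k n}

lemma mem_monomialIdeal_iff {p : MvPolynomial (Fin n) k} :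
    p ∈ monomialIdeal k m ↔ ∀ e ∈ p.support, ∃ v, m v ≤ e := by
  have : monomialIdeal k m = Ideal.span ((fun s => monomial s (1 : k)) '' Set.range m) := by
    rw [monomialIdeal, ← Set.range_comp]
    rfl
  rw [this, mem_ideal_span_monomial_image]
  simp

lemma monomial_mem_monomialIdeal_iff {α : Fin n →₀ ℕ} {c : k} (hc : c ≠ 0) :
    monomial α c ∈ monomialIdeal k m ↔ ∃ v, m v ≤ α := by
  classical
  rw [mem_monomialIdeal_iff, support_monomial, if_neg hc]
  simp

namespace IsMinimalFreeResolution

lemma frame_exact (hF : IsMinimalFreeResolution m F) (i : ℕ) {α : Fin n →₀ ℕ}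
    {x : F.ι (i + 1) → k} (hx : SupportedBelow (F.mdeg (i + 1)) α x)
    (h : F.frame i *ᵥ x = 0) :
    ∃ y, SupportedBelow (F.mdeg (i + 2)) α y ∧ F.frame (i + 1) *ᵥ y = x := by
  refine hF.isComplex.exists_frame_mulVec_eq hx ?_
  refine (hF.exact i _).1 ?_
  rw [Matrix.mulVecLin_apply, IsMultigradedMatrix.mulVec_homogenize (hF.isComplex.multigraded i) hx]
  change homogenize _ _ (F.frame i *ᵥ x) = 0
  rw [h, homogenize_zero]

/-- Between equal multidegrees a multigraded entry is a constant, which minimality forces to vanish.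
-/
lemma mdeg_ne_of_frame_ne_zero (hF : IsMinimalFreeResolution m F) {i : ℕ} {l : F.ι i}
    {j : F.ι (i + 1)} (h : F.frame i l j ≠ 0) : F.mdeg i l ≠ F.mdeg (i + 1) j := by
  intro h1
  have h2 := hF.minimal i l j
  rw [(hF.isComplex.multigraded i l j).eq_monomial, h1, tsub_self] at h2
  rw [constantCoeff_monomial, if_pos rfl] at h2
  exact h h2

lemma diagPart_frame (hF : IsMinimalFreeResolution m F) (i : ℕ) :
    diagPart (F.mdeg i) (F.mdeg (i + 1)) (F.frame i) = 0 := by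
  ext l j
  simp only [diagPart, Matrix.of_apply, Matrix.zero_apply, ite_eq_right_iff]
  intro h
  by_contra h1
  exact hF.mdeg_ne_of_frame_ne_zero h1 h

/-- The difference of `e_j` and `x` is a cycle in the degree of `e_j`, hence a boundary there. A
boundary in that strand has no component at `e_j`, since differentials strictly lower degrees. -/
lemma coeff_eq_one_of_frame_mulVec_eq (hF : IsMinimalFreeResolution m F) {i : ℕ}
    (j : F.ι (i + 1)) {x : F.ι (i + 1) → k}
    (hx : SupportedBelow (F.mdeg (i + 1)) (F.mdeg (i + 1) j) x)
    (h : F.frame i *ᵥ x = (F.frame i).col j) : x j = 1 := by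
  obtain ⟨y, hy, hy'⟩ := hF.frame_exact i (α := F.mdeg (i + 1) j) (x := Pi.single j 1 - x)
    ((supportedBelow_single _ j 1).sub hx)
    (by rw [Matrix.mulVec_sub, h, Matrix.mulVec_single_one, sub_self])
  have h1 : (F.frame (i + 1) *ᵥ y) j = 0 := by
    refine Finset.sum_eq_zero fun l _ => ?_
    by_contra h2
    have h3 := left_ne_zero_of_mul h2
    exact hF.mdeg_ne_of_frame_ne_zero h3 (le_antisymm (hF.isComplex.isFiltered_frame _ j l h3)
      (hy l (right_ne_zero_of_mul h2)))
  rw [hy'] at h1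
  simp only [Pi.sub_apply, Pi.single_eq_same] at h1
  exact (sub_eq_zero.1 h1).symm

/-- A boundary of a basis element is not a boundary in a smaller degree. -/
lemma mdeg_eq_of_frame_mulVec_eq (hF : IsMinimalFreeResolution m F) {i : ℕ} (j : F.ι (i + 1))
    {x : F.ι (i + 1) → k} {α : Fin n →₀ ℕ} (hx : SupportedBelow (F.mdeg (i + 1)) α x)
    (hα : α ≤ F.mdeg (i + 1) j) (h : F.frame i *ᵥ x = (F.frame i).col j) :
    α = F.mdeg (i + 1) j := by
  have h4 := hF.coeff_eq_one_of_frame_mulVec_eq j (hx.mono hα) h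
  exact le_antisymm hα (hx j (by simp [h4]))

lemma exists_frame_ne_zero (hF : IsMinimalFreeResolution m F) {i : ℕ} (j : F.ι (i + 1)) :
    ∃ l, F.frame i l j ≠ 0 := by
  by_contra! h
  have := hF.coeff_eq_one_of_frame_mulVec_eq j (x := 0) (fun l hl => absurd rfl hl)
    (by ext l; simp [h])
  simp at this

/-- The module in homological degree `0` of a minimal resolution of `S/M`. -/
lemma degree_zero (hF : IsMinimalFreeResolution m F) :
    (IsEmpty (F.ι 0) ∧ ∃ v, m v = 0) ∨
      ∃ j₀ : F.ι 0, (∀ j, j = j₀) ∧ F.mdeg 0 j₀ = 0 ∧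
        (∀ v, ∃ x, SupportedBelow (F.mdeg 1) (m v) x ∧ F.frame 0 *ᵥ x = Pi.single j₀ 1) ∧
        ∀ j, ∃ v, m v ≤ F.mdeg 1 j := by
  classical
  obtain ⟨ε, hε, hexact, hsurj⟩ := hF.augmentation
  have hker : ∀ z, ε z = 0 → ∀ j, constantCoeff (z j) = 0 := by
    intro z hz j
    obtain ⟨y, rfl⟩ := (hexact z).1 hz
    rw [Matrix.mulVecLin_apply, Matrix.mulVec, dotProduct, map_sum]
    refine Finset.sum_eq_zero fun l _ => ?_
    rw [map_mul, hF.minimal, zero_mul]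
  choose c hc using hε
  have hsingle : ∀ j p, ε (Pi.single j p) =
      Ideal.Quotient.mk (monomialIdeal k m) (p * monomial (F.mdeg 0 j) (c j)) := by
    intro j p
    rw [← mul_one p, ← smul_eq_mul p 1, Pi.single_smul, map_smul, hc, smul_eq_mul, mul_one]
    rfl
  by_cases htop : ∃ v, m v = 0
  -- Here `M` is the unit ideal, so every generator of `F_0` lies in the image of `F_1`, against
  -- minimality.
  · refine Or.inl ⟨⟨fun j => ?_⟩, htop⟩
    obtain ⟨v, hv⟩ := htop
    have h1 : ε (Pi.single j 1) = 0 := by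
      rw [hc, Ideal.Quotient.eq_zero_iff_mem, mem_monomialIdeal_iff]
      exact fun e _ => ⟨v, by simp [hv]⟩
    simpa using hker _ h1 j
  right
  have hconst : ∀ p ∈ monomialIdeal k m, constantCoeff p = 0 := by
    intro p hp
    by_contra h
    obtain ⟨v, hv⟩ := mem_monomialIdeal_iff.1 hp 0 (mem_support_iff.2 h)
    exact htop ⟨v, le_antisymm hv (zero_le)⟩
  -- For a proper `M`, a lift of `1 ∈ S/M` must have a nonzero constant contribution from some
  -- generator, which therefore has degree 0.
  obtain ⟨j₀, hj₀, hcj₀⟩ : ∃ j, F.mdeg 0 j = 0 ∧ c j ≠ 0 := by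
    obtain ⟨z, hz⟩ := hsurj 1
    have h1 : ε z = Ideal.Quotient.mk (monomialIdeal k m)
        (∑ j, z j * monomial (F.mdeg 0 j) (c j)) := by
      conv_lhs => rw [← Finset.univ_sum_single z, map_sum]
      simp_rw [hsingle, map_sum]
    rw [hz, ← map_one (Ideal.Quotient.mk (monomialIdeal k m)), Ideal.Quotient.mk_eq_mk_iff_sub_mem]
      at h1
    have h2 := hconst _ h1
    rw [map_sub, map_one, sub_eq_zero, map_sum] at h2
    obtain ⟨j, -, hj⟩ := Finset.exists_ne_zero_of_sum_ne_zero (h2 ▸ one_ne_zero)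
    rw [map_mul, constantCoeff_monomial] at hj
    have h3 := right_ne_zero_of_mul hj
    split_ifs at h3 with h4
    · exact ⟨j, h4, h3⟩
    · exact absurd rfl h3
  have huniq : ∀ j, j = j₀ := by
    intro j
    by_contra hj
    -- A second generator would give a relation with coordinate 1, which minimality excludes.
    have h1 : ε (Pi.single j 1 - Pi.single j₀ (monomial (F.mdeg 0 j) (c j / c j₀))) = 0 := by
      rw [map_sub, hsingle, hsingle, monomial_mul, hj₀, add_zero, div_mul_cancel₀ _ hcj₀,
        one_mul, sub_self]
    have h2 := hker _ h1 j
    rw [Pi.sub_apply, Pi.single_eq_same, Pi.single_eq_of_ne hj] at h2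
    simp at h2
  refine ⟨j₀, huniq, hj₀, fun v => ?_, fun j => ?_⟩
  · refine hF.isComplex.exists_frame_mulVec_eq (fun j _ => by rw [huniq j, hj₀]; exact zero_le) ?_
    refine (hexact _).1 ?_
    have h1 : homogenize (F.mdeg 0) (m v) (Pi.single j₀ (1 : k)) =
        Pi.single j₀ (monomial (m v) 1) := by
      ext1 j
      obtain rfl := huniq j
      simp [homogenize, hj₀]
    rw [h1, hsingle, hj₀, monomial_mul, Ideal.Quotient.eq_zero_iff_mem, add_zero, one_mul,
      monomial_mem_monomialIdeal_iff hcj₀]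
    exact ⟨v, le_rfl⟩
  · obtain ⟨l, hl⟩ := hF.exists_frame_ne_zero j
    obtain rfl := huniq l
    have h1 := (hexact (F.mat 0 *ᵥ Pi.single j 1)).2 ⟨_, rfl⟩
    have h2 : F.mat 0 *ᵥ Pi.single j 1 = Pi.single l (F.mat 0 l j) := by
      ext1 i
      obtain rfl := huniq i
      simp
    rw [h2, hsingle, Ideal.Quotient.eq_zero_iff_mem,
      (hF.isComplex.multigraded 0 l j).eq_monomial, hj₀, monomial_mul, add_zero, tsub_zero] at h1
    exact (monomial_mem_monomialIdeal_iff (mul_ne_zero hl hcj₀)).1 h1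

/-- Some `m v` divides the degree of `e_j`, and a scalar multiple of the image of `e_j` is already
attained in degree `m v`. As the boundary of a basis element cannot come from a smaller degree, the
two degrees agree. -/
lemma exists_mdeg_one_eq (hF : IsMinimalFreeResolution m F) (j : F.ι 1) :
    ∃ v, F.mdeg 1 j = m v := by
  obtain ⟨h, -⟩ | ⟨j₀, huniq, -, hx, hv⟩ := hF.degree_zero
  · exact (h.false (hF.exists_frame_ne_zero j).choose).elim
  obtain ⟨v, hv⟩ := hv j
  obtain ⟨x, hx, hx'⟩ := hx v
  refine ⟨v, (hF.mdeg_eq_of_frame_mulVec_eq j (hx.smul (F.frame 0 j₀ j)) hv ?_).symm⟩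
  rw [Matrix.mulVec_smul, hx']
  ext l
  obtain rfl := huniq l
  simp

end IsMinimalFreeResolution
end MinimalResolution

/-! ## The construction -/

section Construction

variable {m : Fin r → (Fin n →₀ ℕ)} {F : BasedSequence k n} {c : k}
  {B : ∀ i, F.ι i → Chain k r i}

lemma fullBoundary_empty (c : Finset (Fin r) → k) : fullBoundary c ∅ = ∑ v, c {v} := by
  simp [fullBoundary, faceSign]

lemma face_zero_val (A : Face r 0) : A.1 = ∅ := Finset.card_eq_zero.1 A.2

/-- The vertices, as faces of dimension `0`. -/
abbrev vertexFace (v : Fin r) : Face r 1 := ⟨{v}, by simp⟩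

lemma exists_eq_vertexFace (A : Face r 1) : ∃ v, A = vertexFace v := by
  obtain ⟨v, hv⟩ := Finset.card_eq_one.1 A.2
  exact ⟨v, Subtype.ext hv⟩

lemma boundary_vertices (x : Chain k r 1) : boundary x = fun _ => ∑ v, x (vertexFace v) := by
  ext A
  rw [boundary_apply, face_zero_val, fullBoundary_empty]
  exact Finset.sum_congr rfl fun v _ => Chain.extend_coe x (vertexFace v)

lemma boundary_single_vertexFace (v : Fin r) (b : k) :
    boundary (b • Pi.single (vertexFace v) 1 : Chain k r 1) = fun _ => b := by
  classical
  rw [boundary_vertices]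
  ext A
  rw [Finset.sum_eq_single v]
  · simp
  · intro w _ hw
    have : vertexFace w ≠ vertexFace v := fun h =>
      hw (Finset.singleton_injective (congrArg Subtype.val h))
    simp [this]
  · simp

lemma frameCycle_supp_subset (i : ℕ) (j : F.ι (i + 1)) :
    (frameCycle F B i j).supp ⊆ frameSupport F B i j := by
  rw [Chain.supp_subset_iff]
  intro A hA
  rw [frameCycle, Finset.sum_apply] at hA
  obtain ⟨l, -, hl⟩ := Finset.exists_ne_zero_of_sum_ne_zero hA
  have h1 : B i l A ≠ 0 := right_ne_zero_of_mul hl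
  refine (Chain.subset_supp h1).trans fun v hv => ?_
  simp only [frameSupport, Finset.mem_biUnion, Finset.mem_filter, Finset.mem_univ, true_and]
  exact ⟨l, left_ne_zero_of_mul hl, hv⟩

lemma boundary_sum_smul {ι : Type*} [Fintype ι] {i : ℕ} (a : ι → k) (g : ι → Chain k r (i + 1)) :
    boundary (∑ l, a l • g l) = ∑ l, a l • boundary (g l) := by
  simp only [boundary, Matrix.mulVec_sum, Matrix.mulVec_smul]

lemma boundary_frameCycle (hF : F.IsComplex) (i : ℕ)
    (h : ∀ j, boundary (B (i + 1) j) = frameCycle F B i j) (j : F.ι (i + 2)) :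
    boundary (frameCycle F B (i + 1) j) = 0 := by
  rw [frameCycle, boundary_sum_smul]
  simp only [h, frameCycle, Finset.smul_sum, smul_smul]
  rw [Finset.sum_comm]
  refine Finset.sum_eq_zero fun l _ => ?_
  rw [← Finset.sum_smul]
  have h1 : (F.frame i * F.frame (i + 1)) l j = 0 := by rw [hF.frame_mul_frame]; rfl
  rw [Matrix.mul_apply] at h1
  simp_rw [mul_comm (F.frame (i + 1) _ _), h1, zero_smul]

lemma IsAdmissibleStep.boundary_eq {i : ℕ} (h : IsAdmissibleStep m F c B (i + 1))
    (j : F.ι (i + 1)) : boundary (B (i + 1) j) = frameCycle F B i j := by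
  cases i with
  | zero => exact (h j).2
  | succ i => exact (h j).1

lemma isAdmissibleStep_congr {B' : ∀ i, F.ι i → Chain k r i} {i : ℕ}
    (h : ∀ i' ≤ i, B' i' = B i') : IsAdmissibleStep m F c B' i ↔ IsAdmissibleStep m F c B i := by
  match i with
  | 0 => simp only [IsAdmissibleStep, h 0 le_rfl]
  | 1 => simp only [IsAdmissibleStep, frameCycle, h 0 zero_le_one, h 1 le_rfl]
  | i + 2 => simp only [IsAdmissibleStep, frameCycle, frameSupport, h (i + 1) (by omega),
      h (i + 2) le_rfl]

/-- The construction can be continued by one step. -/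
lemma exists_admissible_step (hF : IsMinimalFreeResolution m F) (N : ℕ)
    (hB : ∀ i < N, IsAdmissibleStep m F c B i) :
    ∃ b : F.ι N → Chain k r N, IsAdmissibleStep m F c (Function.update B N b) N := by
  match N with
  | 0 => exact ⟨fun _ _ => c, fun j => by simp⟩
  | 1 =>
    choose v hv using hF.exists_mdeg_one_eq
    refine ⟨fun j => (∑ l, F.frame 0 l j * c) • Pi.single (vertexFace (v j)) 1, fun j => ?_⟩
    rw [Function.update_self]
    refine ⟨⟨v j, hv j, _, rfl⟩, ?_⟩
    rw [boundary_single_vertexFace, frameCycle]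
    ext A
    have h0 : IsAdmissibleStep m F c B 0 := hB 0 zero_lt_one
    rw [Function.update_of_ne zero_ne_one, Finset.sum_apply]
    refine Finset.sum_congr rfl fun l _ => ?_
    rw [h0 l]
    rfl
  | i + 2 =>
    have h1 := hB (i + 1) (by omega)
    have h2 : ∀ j : F.ι (i + 2), ∃ y : Chain k r (i + 2),
        (∀ A, y A ≠ 0 → A.1 ⊆ vertexClosure m (frameSupport F B (i + 1) j)) ∧
          boundary y = frameCycle F B (i + 1) j := by
      intro j
      refine exists_boundary_eq _ _ ?_ (boundary_frameCycle hF.isComplex i h1.boundary_eq j)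
      rw [← Chain.supp_subset_iff]
      exact (frameCycle_supp_subset _ j).trans (subset_vertexClosure m _)
    choose b hb hb' using h2
    refine ⟨b, fun j => ?_⟩
    have h3 : i + 1 ≠ i + 2 := by omega
    simp only [Function.update_self, frameCycle, frameSupport, Function.update_of_ne h3]
    exact ⟨hb' j, Chain.supp_subset_iff.2 (hb j)⟩

theorem exists_admissible_completion (hF : IsMinimalFreeResolution m F) (N : ℕ)
    (hB : ∀ i < N, IsAdmissibleStep m F c B i) :
    ∃ B' : ∀ i, F.ι i → Chain k r i, (∀ i < N, B' i = B i) ∧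
      ∀ i, IsAdmissibleStep m F c B' i := by
  let Q : ℕ → Type _ := fun p =>
    {B' : ∀ i, F.ι i → Chain k r i // ∀ i < N + p, IsAdmissibleStep m F c B' i}
  let next : ∀ p, Q p → Q (p + 1) := fun p X =>
    ⟨Function.update X.1 (N + p) (exists_admissible_step hF (N + p) X.2).choose, by
      intro i hi
      rcases Nat.lt_succ_iff_lt_or_eq.1 hi with h | rfl
      · rw [isAdmissibleStep_congr fun i' hi' =>
          Function.update_of_ne (lt_of_le_of_lt hi' h).ne _ _]
        exact X.2 i h
      · exact (exists_admissible_step hF (N + p) X.2).choose_spec⟩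
  let X : ∀ p, Q p := fun p => Nat.rec (motive := Q) ⟨B, hB⟩ next p
  have hX : ∀ p q, p ≤ q → ∀ i < N + p, (X q).1 i = (X p).1 i := by
    intro p q hpq
    induction q, hpq using Nat.le_induction with
    | base => exact fun _ _ => rfl
    | succ q hq ih =>
      intro i hi
      rw [← ih i hi]
      exact Function.update_of_ne (by omega) _ _
  -- Stage `i + 1` has settled all degrees below `N + i + 1`, so degree `i` is included even for `N
  -- = 0`; later stages leave it unchanged.
  refine ⟨fun i => (X (i + 1)).1 i, fun i hi => hX 0 (i + 1) (by omega) i hi, fun i => ?_⟩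
  rw [isAdmissibleStep_congr (B := (X (i + 1)).1)]
  · exact (X (i + 1)).2 i (by omega)
  · intro i' hi'
    exact (hX (i' + 1) (i + 1) (by omega) i' (by omega)).symm

/-- The chains of the construction respect multidegrees. -/
lemma supportedBelow_of_admissible (hF : IsMinimalFreeResolution m F)
    (hB : ∀ i, IsAdmissibleStep m F c B i) (i : ℕ) (j : F.ι i) :
    SupportedBelow (chainDeg m i) (F.mdeg i j) (B i j) := by
  classical
  induction i with
  | zero =>
    intro A _
    rw [faceDeg_le_iff, face_zero_val]
    exact Finset.empty_subset _
  | succ i ih =>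
    have h := hB (i + 1)
    cases i with
    | zero =>
      obtain ⟨⟨v, hv, b, hb⟩, -⟩ := h j
      have : F.mdeg (0 + 1) j = chainDeg m 1 (vertexFace v) := by
        rw [chainDeg, faceDeg, Finset.sup_singleton]
        exact hv
      rw [this, hb]
      exact (supportedBelow_single _ _ 1).smul b
    | succ i =>
      rw [supportedBelow_chainDeg_iff]
      refine (h j).2.trans (vertexClosure_subset_label ?_)
      rw [frameSupport, Finset.biUnion_subset]
      intro l hl
      rw [← supportedBelow_chainDeg_iff]
      exact (ih l).mono (hF.isComplex.isFiltered_frame _ l j (Finset.mem_filter.1 hl).2)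

end Construction

/-! ## The mapping cone -/

section Cone

variable {P : Type*} [PartialOrder P]

/-- The index types of the mapping cone. -/
def ConeIndex (X Y : ℕ → Type) : ℕ → Type
  | 0 => X 0
  | i + 1 => X (i + 1) ⊕ Y i

instance (X Y : ℕ → Type) [∀ i, Fintype (X i)] [∀ i, Fintype (Y i)] :
    ∀ i, Fintype (ConeIndex X Y i)
  | 0 => inferInstanceAs (Fintype (X 0))
  | i + 1 => inferInstanceAs (Fintype (X (i + 1) ⊕ Y i))

instance (X Y : ℕ → Type) [∀ i, DecidableEq (X i)] [∀ i, DecidableEq (Y i)] :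
    ∀ i, DecidableEq (ConeIndex X Y i)
  | 0 => inferInstanceAs (DecidableEq (X 0))
  | i + 1 => inferInstanceAs (DecidableEq (X (i + 1) ⊕ Y i))

/-- The degrees of the mapping cone. -/
def coneDeg {X Y : ℕ → Type} (a : ∀ i, X i → P) (b : ∀ i, Y i → P) : ∀ i, ConeIndex X Y i → P
  | 0 => a 0
  | i + 1 => Sum.elim (a (i + 1)) (b i)

/-- The differential of the mapping cone. -/
def coneMatrix {X Y : ℕ → Type} (D : ∀ i, Matrix (X i) (X (i + 1)) k)
    (E : ∀ i, Matrix (Y i) (Y (i + 1)) k) (φ : ∀ i, Matrix (X i) (Y i) k) :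
    ∀ i, Matrix (ConeIndex X Y i) (ConeIndex X Y (i + 1)) k
  | 0 => Matrix.fromCols (D 0) (φ 0)
  | i + 1 => Matrix.fromBlocks (D (i + 1)) (φ (i + 1)) 0 (-E i)

variable {X Y : ℕ → Type} [∀ i, Fintype (X i)] [∀ i, Fintype (Y i)] [∀ i, DecidableEq (X i)]
  [∀ i, DecidableEq (Y i)]

lemma supportedBelow_elim {X Y : Type} {a : X → P} {b : Y → P} {α : P} {x : X → k} {y : Y → k} :
    SupportedBelow (Sum.elim a b) α (Sum.elim x y) ↔
      SupportedBelow a α x ∧ SupportedBelow b α y := by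
  simp [SupportedBelow]

lemma diagPart_fromCols {P : Type*} [DecidableEq P] {X X' Y : Type} (a : X → P) (a' : X' → P) (b : Y → P)
    (M : Matrix X X' k) (N : Matrix X Y k) :
    diagPart a (Sum.elim a' b) (Matrix.fromCols M N) =
      Matrix.fromCols (diagPart a a' M) (diagPart a b N) := by
  ext l (j | j) <;> rfl

lemma diagPart_fromBlocks {P : Type*} [DecidableEq P] {X X' Y Y' : Type} (a : X → P) (a' : X' → P) (b : Y → P)
    (b' : Y' → P) (M : Matrix X X' k) (N : Matrix X Y' k) (K : Matrix Y X' k) (L : Matrix Y Y' k) :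
    diagPart (Sum.elim a b) (Sum.elim a' b') (Matrix.fromBlocks M N K L) =
      Matrix.fromBlocks (diagPart a a' M) (diagPart a b' N) (diagPart b a' K)
        (diagPart b b' L) := by
  ext (l | l) (j | j) <;> rfl

lemma diagPart_neg {P : Type*} [DecidableEq P] {X Y : Type} (a : X → P) (b : Y → P) (M : Matrix X Y k) :
    diagPart a b (-M) = - diagPart a b M := by
  ext l j
  simp only [diagPart, Matrix.of_apply, Matrix.neg_apply]
  split_ifs <;> simp

/-- A filtered quasi-isomorphism of filtered complexes induces a quasi-isomorphism of the
associated graded complexes; stated when the differential of the source becomes zero. -/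
theorem graded_quasiIso [DecidableEq P] (a : ∀ i, X i → P) (b : ∀ i, Y i → P)
    (D : ∀ i, Matrix (X i) (X (i + 1)) k) (E : ∀ i, Matrix (Y i) (Y (i + 1)) k)
    (φ : ∀ i, Matrix (X i) (Y i) k)
    (hD : ∀ i, IsFiltered (a i) (a (i + 1)) (D i)) (hE : ∀ i, IsFiltered (b i) (b (i + 1)) (E i))
    (hφ : ∀ i, IsFiltered (a i) (b i) (φ i))
    (hDD : ∀ i, D i * D (i + 1) = 0) (hEE : ∀ i, E i * E (i + 1) = 0)
    (hDφ : ∀ i, D i * φ (i + 1) = φ i * E i)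
    (exactD : ∀ i α x, SupportedBelow (a (i + 1)) α x → D i *ᵥ x = 0 →
      ∃ y, SupportedBelow (a (i + 2)) α y ∧ D (i + 1) *ᵥ y = x)
    (exactE : ∀ i α x, SupportedBelow (b (i + 1)) α x → E i *ᵥ x = 0 →
      ∃ y, SupportedBelow (b (i + 2)) α y ∧ E (i + 1) *ᵥ y = x)
    (surj : ∀ α x, SupportedBelow (a 0) α x → ∃ y z, SupportedBelow (a 1) α y ∧
      SupportedBelow (b 0) α z ∧ D 0 *ᵥ y + φ 0 *ᵥ z = x)
    (inj : ∀ α y z, SupportedBelow (a 1) α y → SupportedBelow (b 0) α z →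
      D 0 *ᵥ y + φ 0 *ᵥ z = 0 → ∃ w, SupportedBelow (b 1) α w ∧ E 0 *ᵥ w = z)
    (hE0 : ∀ i, diagPart (b i) (b (i + 1)) (E i) = 0) :
    (∀ y, ∃ x y', diagPart (a 0) (b 0) (φ 0) *ᵥ x + diagPart (a 0) (a 1) (D 0) *ᵥ y' = y) ∧
    (∀ i y, diagPart (a i) (a (i + 1)) (D i) *ᵥ y = 0 →
      ∃ x y', diagPart (a (i + 1)) (b (i + 1)) (φ (i + 1)) *ᵥ x +
        diagPart (a (i + 1)) (a (i + 2)) (D (i + 1)) *ᵥ y' = y) ∧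
    ∀ i x y, diagPart (a i) (b i) (φ i) *ᵥ x + diagPart (a i) (a (i + 1)) (D i) *ᵥ y = 0 →
      x = 0 := by
  have hC : ∀ i, IsFiltered (coneDeg a b i) (coneDeg a b (i + 1)) (coneMatrix D E φ i) := by
    rintro (_ | i)
    · rintro l (j | j) h
      · exact hD 0 l j h
      · exact hφ 0 l j h
    · rintro (l | l) (j | j) h
      · exact hD (i + 1) l j h
      · exact hφ (i + 1) l j h
      · exact absurd rfl h
      · exact hE i l j (neg_ne_zero.1 h)
  have hCC : ∀ i, coneMatrix D E φ i * coneMatrix D E φ (i + 1) = 0 := by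
    rintro (_ | i)
    · have h : Matrix.fromCols (D 0) (φ 0) * Matrix.fromBlocks (D 1) (φ 1) 0 (-E 0) = 0 := by
        rw [Matrix.fromCols_mul_fromBlocks]
        simp [hDD, hDφ]
      exact h
    · have h : Matrix.fromBlocks (D (i + 1)) (φ (i + 1)) 0 (-E i) *
          Matrix.fromBlocks (D (i + 2)) (φ (i + 2)) 0 (-E (i + 1)) = 0 := by
        rw [Matrix.fromBlocks_multiply]
        simp [hDD, hDφ, hEE]
      exact h
  obtain ⟨s, hs, hs0, hsC⟩ := exists_filtered_contraction (coneDeg a b) (coneMatrix D E φ) hC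
    (by
      intro α x hx
      obtain ⟨y, z, hy, hz, h⟩ := surj α x hx
      exact ⟨Sum.elim y z, supportedBelow_elim.2 ⟨hy, hz⟩,
        (Matrix.fromCols_mulVec_sumElim _ _ _ _).trans h⟩)
    (by
      rintro (_ | i) α x hx h
      · obtain ⟨y, z, rfl⟩ : ∃ y z, x = Sum.elim y z := ⟨_, _, (Sum.elim_comp_inl_inr x).symm⟩
        obtain ⟨hy, hz⟩ := supportedBelow_elim.1 hx
        have h' : D 0 *ᵥ y + φ 0 *ᵥ z = 0 := (Matrix.fromCols_mulVec_sumElim _ _ _ _).symm.trans h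
        obtain ⟨w, hw, hw'⟩ := inj α y z hy hz h'
        -- Once the source component is filled by `w`, the correction by `φ w` makes the target
        -- component a cycle; the sign of `-w` matches that of `-E`.
        obtain ⟨u, hu, hu'⟩ := exactD 0 α (y + φ 1 *ᵥ w) (hy.add ((hφ 1).mulVec hw)) (by
          rw [Matrix.mulVec_add, Matrix.mulVec_mulVec, hDφ, ← Matrix.mulVec_mulVec, hw', h'])
        refine ⟨Sum.elim u (-w), supportedBelow_elim.2 ⟨hu, hw.neg⟩, ?_⟩
        refine (Matrix.fromBlocks_mulVec _ _ _ _ _).trans ?_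
        simp [hu', hw', Matrix.mulVec_neg, Matrix.neg_mulVec]
      · obtain ⟨y, z, rfl⟩ : ∃ y z, x = Sum.elim y z := ⟨_, _, (Sum.elim_comp_inl_inr x).symm⟩
        obtain ⟨hy, hz⟩ := supportedBelow_elim.1 hx
        have h' := (Matrix.fromBlocks_mulVec _ _ _ _ _).symm.trans h
        have h1 : D (i + 1) *ᵥ y + φ (i + 1) *ᵥ z = 0 := congrArg (· ∘ Sum.inl) h'
        have h2 : (0 : Matrix (Y i) (X (i + 2)) k) *ᵥ y + (-E i) *ᵥ z = 0 :=
          congrArg (· ∘ Sum.inr) h'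
        simp only [Matrix.zero_mulVec, Matrix.neg_mulVec, zero_add, neg_eq_zero] at h2
        obtain ⟨w, hw, hw'⟩ := exactE i α z hz h2
        obtain ⟨u, hu, hu'⟩ := exactD (i + 1) α (y + φ (i + 2) *ᵥ w)
          (hy.add ((hφ (i + 2)).mulVec hw)) (by
          rw [Matrix.mulVec_add, Matrix.mulVec_mulVec, hDφ, ← Matrix.mulVec_mulVec, hw', h1])
        refine ⟨Sum.elim u (-w), supportedBelow_elim.2 ⟨hu, hw.neg⟩, ?_⟩
        refine (Matrix.fromBlocks_mulVec _ _ _ _ _).trans ?_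
        simp [hu', hw', Matrix.mulVec_neg, Matrix.neg_mulVec])
    hCC
  have hC0 : ∀ y x, diagPart (coneDeg a b 0) (coneDeg a b 1) (coneMatrix D E φ 0) *ᵥ Sum.elim y x =
      diagPart (a 0) (b 0) (φ 0) *ᵥ x + diagPart (a 0) (a 1) (D 0) *ᵥ y := by
    intro y x
    exact (congrArg (· *ᵥ Sum.elim y x) (diagPart_fromCols _ _ _ _ _)).trans
      ((Matrix.fromCols_mulVec_sumElim _ _ _ _).trans (add_comm _ _))
  have hC1 : ∀ i y x, diagPart (coneDeg a b (i + 1)) (coneDeg a b (i + 2))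
      (coneMatrix D E φ (i + 1)) *ᵥ Sum.elim y x =
      Sum.elim (diagPart (a (i + 1)) (b (i + 1)) (φ (i + 1)) *ᵥ x +
        diagPart (a (i + 1)) (a (i + 2)) (D (i + 1)) *ᵥ y) 0 := by
    intro i y x
    refine (congrArg (· *ᵥ Sum.elim y x) (diagPart_fromBlocks _ _ _ _ _ _ _ _)).trans
      ((Matrix.fromBlocks_mulVec _ _ _ _ _).trans ?_)
    rw [diagPart_neg, hE0, diagPart_zero]
    simp [add_comm]
  have key0 : ∀ y, ∃ z, diagPart (coneDeg a b 0) (coneDeg a b 1) (coneMatrix D E φ 0) *ᵥ z = y := by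
    intro y
    refine ⟨diagPart (coneDeg a b 1) (coneDeg a b 0) (s 0) *ᵥ y, ?_⟩
    rw [diagPart_mulVec_mulVec (hC 0) (hs 0), hs0, diagPart_one, Matrix.one_mulVec]
  have key1 : ∀ i y, diagPart (coneDeg a b i) (coneDeg a b (i + 1)) (coneMatrix D E φ i) *ᵥ y = 0 →
      ∃ z, diagPart (coneDeg a b (i + 1)) (coneDeg a b (i + 2)) (coneMatrix D E φ (i + 1)) *ᵥ z =
        y := by
    intro i y hy
    refine ⟨diagPart (coneDeg a b (i + 2)) (coneDeg a b (i + 1)) (s (i + 1)) *ᵥ y, ?_⟩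
    have h := congrArg (fun M => diagPart (coneDeg a b (i + 1)) (coneDeg a b (i + 1)) M *ᵥ y)
      (hsC i)
    simp only [diagPart_add, diagPart_one, Matrix.one_mulVec, Matrix.add_mulVec] at h
    rw [← diagPart_mulVec_mulVec (hs i) (hC i), hy, Matrix.mulVec_zero, add_zero,
      ← diagPart_mulVec_mulVec (hC (i + 1)) (hs (i + 1))] at h
    exact h
  refine ⟨fun y => ?_, fun i y hy => ?_, fun i x y hxy => ?_⟩
  · obtain ⟨z, hz⟩ := key0 y
    obtain ⟨u, v, rfl⟩ : ∃ u v, z = Sum.elim u v := ⟨_, _, (Sum.elim_comp_inl_inr z).symm⟩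
    exact ⟨v, u, (hC0 u v).symm.trans hz⟩
  · obtain ⟨z, hz⟩ := key1 i (Sum.elim y 0) (by
      cases i with
      | zero =>
        refine (hC0 _ _).trans ?_
        rw [hy, Matrix.mulVec_zero, add_zero]
        rfl
      | succ i =>
        refine (hC1 i _ _).trans ?_
        rw [hy, Matrix.mulVec_zero, add_zero]
        exact Sum.elim_zero_zero)
    obtain ⟨u, v, rfl⟩ : ∃ u v, z = Sum.elim u v := ⟨_, _, (Sum.elim_comp_inl_inr z).symm⟩
    exact ⟨v, u, congrArg (· ∘ Sum.inl) ((hC1 i u v).symm.trans hz)⟩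
  -- The pair is a cycle of the graded cone, hence a boundary, and graded boundaries have zero
  -- source component because `diagPart` kills `E`.
  · obtain ⟨z, hz⟩ := key1 i (Sum.elim y x) (by
      cases i with
      | zero => exact (hC0 _ _).trans hxy
      | succ i =>
        refine (hC1 i _ _).trans ?_
        rw [hxy]
        exact Sum.elim_zero_zero)
    obtain ⟨u, v, rfl⟩ : ∃ u v, z = Sum.elim u v := ⟨_, _, (Sum.elim_comp_inl_inr z).symm⟩
    exact (congrArg (· ∘ Sum.inr) ((hC1 i u v).symm.trans hz)).symm

end Cone

/-! ## Homogenized bases -/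

section HomogenizedBasis

variable {X G H : Type} [Fintype G] {a : X → (Fin n →₀ ℕ)} {b : G → (Fin n →₀ ℕ)} {b' : H → (Fin n →₀ ℕ)}

/-- This lifts matrix identities over `k` to the relations over `S` that a change of basis must
satisfy. -/
lemma sum_smul_homogenize {P : Matrix X G k} (hP : IsFiltered a b P)
    {M : Matrix G H (MvPolynomial (Fin n) k)} (hM : IsMultigradedMatrix b b' M) (j : H) :
    ∑ l, M l j • homogenize a (b l) (P.col l) =
      homogenize a (b' j) ((P * M.map (eval fun _ => 1)).col j) := by
  ext1 A
  simp only [Finset.sum_apply, Pi.smul_apply, homogenize, Matrix.col_apply, Matrix.mul_apply,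
    map_sum, smul_eq_mul, Matrix.map_apply]
  refine Finset.sum_congr rfl fun l _ => ?_
  conv_lhs => rw [(hM l j).eq_monomial, monomial_mul]
  by_cases h1 : eval (fun _ => 1) (M l j) = 0
  · simp [h1]
  by_cases h2 : P A l = 0
  · simp [h2]
  rw [tsub_add_tsub_cancel (hM.isFiltered l j h1) (hP A l h2), mul_comm]

/-- A graded form of Nakayama's lemma: a homogeneous family that is a basis modulo the variables is
a basis. -/
lemma exists_homogenized_basis [Fintype X] [DecidableEq X] {P : Matrix X G k} (hP : IsFiltered a b P)
    (hinj : ∀ w, diagPart a b P *ᵥ w = 0 → w = 0) (hsurj : ∀ y, ∃ w, diagPart a b P *ᵥ w = y) :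
    ∃ f : Module.Basis G (MvPolynomial (Fin n) k) (X → MvPolynomial (Fin n) k),
      ∀ g, f g = homogenize a (b g) (P.col g) := by
  have hcard : Fintype.card G = Fintype.card X := by
    have e := LinearEquiv.ofBijective (diagPart a b P).mulVecLin
      ⟨(injective_iff_map_eq_zero _).2 hinj, hsurj⟩
    simpa using e.finrank_eq
  let f : G → X → MvPolynomial (Fin n) k := fun g => homogenize a (b g) (P.col g)
  have hsingle : ∀ x (p : MvPolynomial (Fin n) k),
      Pi.single x (1 : MvPolynomial (Fin n) k) ∈
        Submodule.span (MvPolynomial (Fin n) k) (Set.range f) →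
      Pi.single x p ∈ Submodule.span (MvPolynomial (Fin n) k) (Set.range f) := by
    intro x p hx
    rw [← mul_one p, ← smul_eq_mul, Pi.single_smul]
    exact Submodule.smul_mem _ _ hx
  have hspan : ∀ α : Fin n →₀ ℕ, ∀ x, a x = α →
      Pi.single x (1 : MvPolynomial (Fin n) k) ∈
        Submodule.span (MvPolynomial (Fin n) k) (Set.range f) := by
    intro α
    induction α using WellFoundedLT.induction with
    | ind α ih =>
      intro x hx
      obtain ⟨w, hw⟩ := hsurj (Pi.single x 1)
      -- Keeping only the coefficients of degree exactly `α` makes the combination homogeneous. It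
      -- then differs from the basis vector only at coordinates of smaller degree, which the
      -- induction covers.
      let u : G → k := fun g => if b g = α then w g else 0
      let z : X → MvPolynomial (Fin n) k := ∑ g, (C (u g) : MvPolynomial (Fin n) k) • f g
      have hz : z ∈ Submodule.span (MvPolynomial (Fin n) k) (Set.range f) :=
        Submodule.sum_mem _ fun g _ => Submodule.smul_mem _ _ (Submodule.subset_span ⟨g, rfl⟩)
      have hzy : ∀ y, z y = monomial (α - a y) ((P *ᵥ u) y) := by
        intro y
        simp only [z, f, Finset.sum_apply, Pi.smul_apply, homogenize, Matrix.mulVec, dotProduct,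
          map_sum, smul_eq_mul, C_mul_monomial, Matrix.col_apply]
        refine Finset.sum_congr rfl fun g _ => ?_
        by_cases h : b g = α
        · rw [h, mul_comm]
        · simp [u, h]
      have hlow : ∀ y, ¬ a y < α → z y = (Pi.single x 1 : X → MvPolynomial (Fin n) k) y := by
        intro y hy
        rw [hzy]
        by_cases hyα : a y = α
        · have h1 : (P *ᵥ u) y = (Pi.single x 1 : X → k) y := by
            rw [← hw]
            refine Finset.sum_congr rfl fun g _ => ?_
            simp only [diagPart, Matrix.of_apply, u, hyα]
            by_cases h : b g = α
            · rw [if_pos h, if_pos h.symm]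
            · rw [if_neg h, if_neg (Ne.symm h), mul_zero, zero_mul]
          rw [h1, hyα, tsub_self]
          by_cases hyx : y = x
          · subst hyx
            simp
          · simp [Pi.single_eq_of_ne hyx]
        · have h1 : (P *ᵥ u) y = 0 := by
            refine Finset.sum_eq_zero fun g _ => ?_
            by_cases h : b g = α
            · by_cases h2 : P y g = 0
              · exact mul_eq_zero_of_left h2 _
              · exact absurd (lt_of_le_of_ne (h ▸ hP y g h2) hyα) hy
            · simp [u, h]
          have hyx : y ≠ x := by
            rintro rfl
            exact hyα hx
          rw [h1, map_zero, Pi.single_eq_of_ne hyx]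
      have hdiff : z - Pi.single x 1 ∈
          Submodule.span (MvPolynomial (Fin n) k) (Set.range f) := by
        rw [← Finset.univ_sum_single (z - Pi.single x 1)]
        refine Submodule.sum_mem _ fun y _ => ?_
        by_cases hy : a y < α
        · exact hsingle _ _ (ih _ hy y rfl)
        · rw [Pi.sub_apply, hlow y hy, sub_self, Pi.single_zero]
          exact Submodule.zero_mem _
      have := Submodule.sub_mem _ hz hdiff
      rwa [sub_sub_cancel] at this
  have htop : ⊤ ≤ Submodule.span (MvPolynomial (Fin n) k) (Set.range f) := by
    intro y _
    rw [← Finset.univ_sum_single y]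
    exact Submodule.sum_mem _ fun x _ => hsingle _ _ (hspan _ x rfl)
  refine ⟨basisOfTopLeSpanOfCardEqFinrank f htop (by rw [hcard]; simp), fun g => ?_⟩
  rw [coe_basisOfTopLeSpanOfCardEqFinrank]

end HomogenizedBasis

/-! ### The chain map from the resolution to the Taylor complex -/

section TaylorBasis

variable {m : Fin r → (Fin n →₀ ℕ)} {F : BasedSequence k n} {c : k}
  {B : ∀ i, F.ι i → Chain k r i}

/-- The matrix whose columns are the chains of a family. -/
def chainMatrix (F : BasedSequence k n) (B : ∀ i, F.ι i → Chain k r i) (i : ℕ) :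
    Matrix (Face r i) (F.ι i) k := Matrix.of fun A j => B i j A

lemma boundaryMatrix_mul_chainMatrix (i : ℕ)
    (h : ∀ j, boundary (B (i + 1) j) = frameCycle F B i j) :
    boundaryMatrix k r i * chainMatrix F B (i + 1) = chainMatrix F B i * F.frame i := by
  ext A j
  refine (congrFun (h j) A).trans ?_
  simp [frameCycle, chainMatrix, Matrix.mul_apply, mul_comm]

lemma chainDeg_vertexFace (v : Fin r) : chainDeg m 1 (vertexFace v) = m v :=
  Finset.sup_singleton

/-- The chain map given by the construction is a quasi-isomorphism modulo the variables. -/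
lemma graded_quasiIso_of_admissible (hF : IsMinimalFreeResolution m F) (hc : c ≠ 0)
    (hB : ∀ i, IsAdmissibleStep m F c B i) :
    (∀ y, ∃ x y', diagPart (chainDeg m 0) (F.mdeg 0) (chainMatrix F B 0) *ᵥ x +
      diagPart (chainDeg m 0) (chainDeg m 1) (boundaryMatrix k r 0) *ᵥ y' = y) ∧
    (∀ i y, diagPart (chainDeg m i) (chainDeg m (i + 1)) (boundaryMatrix k r i) *ᵥ y = 0 →
      ∃ x y', diagPart (chainDeg m (i + 1)) (F.mdeg (i + 1)) (chainMatrix F B (i + 1)) *ᵥ x +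
        diagPart (chainDeg m (i + 1)) (chainDeg m (i + 2)) (boundaryMatrix k r (i + 1)) *ᵥ y' =
          y) ∧
    ∀ i x y, diagPart (chainDeg m i) (F.mdeg i) (chainMatrix F B i) *ᵥ x +
      diagPart (chainDeg m i) (chainDeg m (i + 1)) (boundaryMatrix k r i) *ᵥ y = 0 → x = 0 := by
  have hφ0 : ∀ z, chainMatrix F B 0 *ᵥ z = fun _ => ∑ j, c * z j := by
    intro z
    have h : IsAdmissibleStep m F c B 0 := hB 0
    ext A
    refine Finset.sum_congr rfl fun j _ => ?_
    change B 0 j A * z j = c * z j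
    rw [h j]
  refine graded_quasiIso (chainDeg m) F.mdeg (boundaryMatrix k r) F.frame (chainMatrix F B)
    (isFiltered_boundaryMatrix m) hF.isComplex.isFiltered_frame
    (fun i l j h => supportedBelow_of_admissible hF hB i j l h)
    boundaryMatrix_mul hF.isComplex.frame_mul_frame
    (fun i => boundaryMatrix_mul_chainMatrix i (hB (i + 1)).boundary_eq)
    (fun i α x => exists_boundary_eq_of_supportedBelow x) (fun i α x => hF.frame_exact i)
    ?_ ?_ hF.diagPart_frame
  · intro α x _
    obtain ⟨t, rfl⟩ : ∃ t, x = fun _ => t := by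
      refine ⟨x ⟨∅, rfl⟩, ?_⟩
      ext A
      congr 1
      exact Subtype.ext (face_zero_val A)
    -- If `M` is the unit ideal, `∅` bounds a vertex of degree 0; otherwise it is hit by the
    -- generator of `F_0`, because `c ≠ 0`.
    obtain ⟨-, v, hv⟩ | ⟨j₀, huniq, hj₀, -, -⟩ := hF.degree_zero
    · refine ⟨t • Pi.single (vertexFace v) 1, 0, ?_, fun _ h => absurd rfl h, ?_⟩
      · refine ((supportedBelow_single (chainDeg m 1) (vertexFace v) 1).smul t).mono ?_
        rw [chainDeg_vertexFace, hv]
        exact zero_le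
      · rw [Matrix.mulVec_zero, add_zero]
        exact boundary_single_vertexFace v t
    · refine ⟨0, Pi.single j₀ (t / c), fun _ h => absurd rfl h, ?_, ?_⟩
      · refine (supportedBelow_single _ _ _).mono ?_
        rw [hj₀]
        exact zero_le
      · rw [Matrix.mulVec_zero, zero_add, hφ0]
        ext
        rw [Finset.sum_eq_single j₀ (fun j _ h => absurd (huniq j) h) (by simp),
          Pi.single_eq_same, mul_div_cancel₀ _ hc]
  · intro α y z hy hz h
    obtain ⟨hempty, -⟩ | ⟨j₀, huniq, hj₀, hx, -⟩ := hF.degree_zero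
    · exact ⟨0, fun _ h => absurd rfl h, Subsingleton.elim _ _⟩
    -- Without vertices in `y`, the equation gives `c * z = 0`. A vertex in `y` puts `α` in `M`, and
    -- there the generator of `F_0` is a boundary.
    by_cases hy0 : y = 0
    · refine ⟨0, fun _ h => absurd rfl h, ?_⟩
      rw [hy0, Matrix.mulVec_zero, zero_add, hφ0] at h
      have h1 := congrFun h ⟨∅, rfl⟩
      rw [Finset.sum_eq_single j₀ (fun j _ h => absurd (huniq j) h) (by simp)] at h1
      rw [Matrix.mulVec_zero]
      ext j
      rw [huniq j]
      exact ((mul_eq_zero.1 h1).resolve_left hc).symm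
    · obtain ⟨A, hA⟩ := Function.ne_iff.1 hy0
      obtain ⟨v, rfl⟩ := exists_eq_vertexFace A
      obtain ⟨x, hx, hx'⟩ := hx v
      have hv := hy _ hA
      rw [chainDeg_vertexFace] at hv
      refine ⟨z j₀ • x, (hx.mono hv).smul _, ?_⟩
      rw [Matrix.mulVec_smul, hx']
      ext j
      obtain rfl := huniq j
      simp

end TaylorBasis

/-! ### Matrices selecting basis vectors -/

section Select

variable {σ X P : Type*} [Fintype σ] [DecidableEq X]

/-- The matrix whose columns are the basis vectors with indices `e s`. -/
def selectMatrix (k : Type*) [Field k] {σ X : Type*} [DecidableEq X] (e : σ → X) :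
    Matrix X σ k := (1 : Matrix X X k).submatrix id e

lemma selectMatrix_mulVec_apply {e : σ → X} (he : Function.Injective e) (u : σ → k) (s : σ) :
    (selectMatrix k e *ᵥ u) (e s) = u s := by
  classical
  simp [selectMatrix, Matrix.mulVec, dotProduct, Matrix.one_apply, he.eq_iff]

lemma selectMatrix_mulVec_of_notMem {e : σ → X} (u : σ → k) {x : X} (hx : x ∉ Set.range e) :
    (selectMatrix k e *ᵥ u) x = 0 := by
  refine Finset.sum_eq_zero fun s _ => mul_eq_zero_of_left ?_ _
  exact Matrix.one_apply_ne fun h => hx ⟨s, h.symm⟩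

lemma selectMatrix_mulVec_comp {e : σ → X} (he : Function.Injective e) {c : X → k}
    (hc : ∀ x ∉ Set.range e, c x = 0) : selectMatrix k e *ᵥ (c ∘ e) = c := by
  ext x
  by_cases hx : x ∈ Set.range e
  · obtain ⟨s, rfl⟩ := hx
    exact selectMatrix_mulVec_apply he _ s
  · rw [hc x hx, selectMatrix_mulVec_of_notMem _ hx]

lemma eq_zero_of_selectMatrix_mulVec {e : σ → X} (he : Function.Injective e) {u : σ → k}
    (h : selectMatrix k e *ᵥ u = 0) : u = 0 := by
  ext s
  rw [← selectMatrix_mulVec_apply he u s, h]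
  rfl

lemma isFiltered_selectMatrix {σ : Type*} [PartialOrder P] (a : X → P) (e : σ → X) :
    IsFiltered a (fun s => a (e s)) (selectMatrix k e) := by
  intro x s h
  by_contra hx
  refine h (Matrix.one_apply_ne ?_)
  rintro rfl
  exact hx le_rfl

lemma diagPart_selectMatrix {σ : Type*} [DecidableEq P] (a : X → P) (e : σ → X) :
    diagPart a (fun s => a (e s)) (selectMatrix k e) = selectMatrix k e := by
  ext x s
  simp only [diagPart, Matrix.of_apply]
  split_ifs with h
  · rfl
  · refine (Matrix.one_apply_ne ?_).symm
    rintro rfl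
    exact h rfl

end Select

/-! ### The Taylor differential and the simplicial boundary -/

section TaylorMatrix

variable (m : Fin r → (Fin n →₀ ℕ))

lemma isMultigradedMatrix_taylorResolution (i : ℕ) :
    IsMultigradedMatrix (chainDeg m i) (chainDeg m (i + 1)) ((taylorResolution k m).mat i) :=
  fun A B => isMultigradedCoeff_monomial fun h => isFiltered_boundaryMatrix m i A B h

lemma taylorResolution_mat_map (i : ℕ) :
    ((taylorResolution k m).mat i).map (eval fun _ => 1) = boundaryMatrix k r i := by
  ext A B
  change eval (fun _ => 1) (monomial (faceDeg m B.1 - faceDeg m A.1) (boundaryMatrix k r i A B)) = _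
  simp [eval_monomial]

lemma taylorResolution_mat_mulVec {i : ℕ} {α : Fin n →₀ ℕ} {x : Chain k r (i + 1)}
    (hx : SupportedBelow (chainDeg m (i + 1)) α x) :
    (taylorResolution k m).mat i *ᵥ homogenize (chainDeg m (i + 1)) α x =
      homogenize (chainDeg m i) α (boundary x) :=
  (IsMultigradedMatrix.mulVec_homogenize (isMultigradedMatrix_taylorResolution m i) hx).trans
    (congrArg (fun M => homogenize (chainDeg m i) α (M *ᵥ x)) (taylorResolution_mat_map m i))

end TaylorMatrix

/-! ## Outcomes of the construction are Taylor bases -/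

section Split

variable {m : Fin r → (Fin n →₀ ℕ)} {F : BasedSequence k n} {c : k}
  {B : ∀ i, F.ι i → Chain k r i} {q : ℕ} {t : Fin q → ℕ} {E : Fin q → Finset (Fin r)}

/-- The faces `E s`, of dimension `t s`, as basis elements of the Taylor resolution. -/
def sourceFace (ht : ∀ s, (E s).card = t s + 1) (i : ℕ) (s : {s : Fin q // t s + 1 = i}) :
    Face r i := ⟨E s, (ht s).trans s.2⟩

/-- The faces `E s`, of dimension `t s`, indexed by the homological degree of their boundary. -/
def targetFace (ht : ∀ s, (E s).card = t s + 1) (i : ℕ) (s : {s : Fin q // t s = i}) :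
    Face r (i + 1) := ⟨E s, by rw [ht, s.2]⟩

/-- The chains of `B`, the boundaries of the faces `E s`, and the faces `E s`. -/
def splitMatrix (F : BasedSequence k n) (B : ∀ i, F.ι i → Chain k r i)
    (ht : ∀ s, (E s).card = t s + 1) (i : ℕ) :
    Matrix (Face r i) (F.ι i ⊕ {s : Fin q // t s = i} ⊕ {s : Fin q // t s + 1 = i}) k :=
  Matrix.fromCols (chainMatrix F B i)
    (Matrix.fromCols (boundaryMatrix k r i * selectMatrix k (targetFace ht i))
      (selectMatrix k (sourceFace ht i)))

/-- The multidegrees of the columns of `splitMatrix`. -/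
def splitDeg (m : Fin r → (Fin n →₀ ℕ)) (F : BasedSequence k n) (t : Fin q → ℕ)
    (E : Fin q → Finset (Fin r)) (i : ℕ) :
    F.ι i ⊕ {s : Fin q // t s = i} ⊕ {s : Fin q // t s + 1 = i} → (Fin n →₀ ℕ) :=
  Sum.elim (F.mdeg i) (Sum.elim (fun s => faceDeg m (E s)) (fun s => faceDeg m (E s)))

/-- The differential of the direct sum of `F` and a trivial complex. -/
def splitDifferential (F : BasedSequence k n) (t : Fin q → ℕ) (i : ℕ) :
    Matrix (F.ι i ⊕ {s : Fin q // t s = i} ⊕ {s : Fin q // t s + 1 = i})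
      (F.ι (i + 1) ⊕ {s : Fin q // t s = i + 1} ⊕ {s : Fin q // t s + 1 = i + 1})
      (MvPolynomial (Fin n) k) :=
  Matrix.fromBlocks (F.mat i) 0 0
    (Matrix.fromBlocks 0 (Matrix.of fun s s' => if s.1 = s'.1 then 1 else 0) 0 0)

lemma isMultigradedMatrix_splitDifferential (hF : F.IsComplex) (i : ℕ) :
    IsMultigradedMatrix (splitDeg m F t E i) (splitDeg m F t E (i + 1))
      (splitDifferential F t i) := by
  have h0 : ∀ a b : Fin n →₀ ℕ, IsMultigradedCoeff a b (0 : MvPolynomial (Fin n) k) := by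
    intro a b e he
    simp at he
  rintro (l | l | l) (j | j | j)
  · exact hF.multigraded i l j
  · exact h0 _ _
  · exact h0 _ _
  · exact h0 _ _
  · exact h0 _ _
  · change IsMultigradedCoeff (faceDeg m (E j.1)) (faceDeg m (E l.1))
      (if l.1 = j.1 then (1 : MvPolynomial (Fin n) k) else 0)
    split_ifs with h
    · rw [h]
      have := isMultigradedCoeff_monomial (a := faceDeg m (E j.1)) (b := faceDeg m (E j.1))
        (c := (1 : k)) fun _ => le_rfl
      rwa [tsub_self] at this
    · exact h0 _ _
  · exact h0 _ _
  · exact h0 _ _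
  · exact h0 _ _

lemma isFiltered_chainMatrix (hF : IsMinimalFreeResolution m F)
    (hB : ∀ i, IsAdmissibleStep m F c B i) (i : ℕ) :
    IsFiltered (chainDeg m i) (F.mdeg i) (chainMatrix F B i) :=
  fun A j h => supportedBelow_of_admissible hF hB i j A h

lemma isFiltered_splitMatrix (hF : IsMinimalFreeResolution m F)
    (hB : ∀ i, IsAdmissibleStep m F c B i) (ht : ∀ s, (E s).card = t s + 1) (i : ℕ) :
    IsFiltered (chainDeg m i) (splitDeg m F t E i) (splitMatrix F B ht i) := by
  rintro A (j | j | j) h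
  · exact supportedBelow_of_admissible hF hB i j A h
  · exact ((isFiltered_boundaryMatrix m i).mulVec ((isFiltered_selectMatrix (chainDeg m (i + 1))
      (targetFace ht i)).supportedBelow_col j)) A h
  · exact isFiltered_selectMatrix (chainDeg m i) (sourceFace ht i) A j h

lemma diagPart_splitMatrix_mulVec (ht : ∀ s, (E s).card = t s + 1) (i : ℕ) (x : F.ι i → k)
    (u : {s : Fin q // t s = i} → k) (v : {s : Fin q // t s + 1 = i} → k) :
    diagPart (chainDeg m i) (splitDeg m F t E i) (splitMatrix F B ht i) *ᵥ
        Sum.elim x (Sum.elim u v) =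
      diagPart (chainDeg m i) (F.mdeg i) (chainMatrix F B i) *ᵥ x +
        diagPart (chainDeg m i) (chainDeg m (i + 1)) (boundaryMatrix k r i) *ᵥ
          (selectMatrix k (targetFace ht i) *ᵥ u) + selectMatrix k (sourceFace ht i) *ᵥ v := by
  rw [splitMatrix, splitDeg, diagPart_fromCols, diagPart_fromCols, Matrix.fromCols_mulVec_sumElim,
    Matrix.fromCols_mulVec_sumElim, add_assoc]
  congr 2
  · rw [Matrix.mulVec_mulVec]
    congr 1
    refine (diagPart_mul (isFiltered_boundaryMatrix m i)
      (isFiltered_selectMatrix (chainDeg m (i + 1)) (targetFace ht i))).trans ?_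
    rw [diagPart_selectMatrix]
  · congr 1
    exact diagPart_selectMatrix (chainDeg m i) (sourceFace ht i)

/-- Blockwise: the chains satisfy the frame equations, boundaries have zero boundary, and each added
face maps to its own listed boundary. -/
lemma boundaryMatrix_mul_splitMatrix (hB : ∀ i, IsAdmissibleStep m F c B i)
    (ht : ∀ s, (E s).card = t s + 1) (i : ℕ) :
    boundaryMatrix k r i * splitMatrix F B ht (i + 1) =
      splitMatrix F B ht i * (splitDifferential F t i).map (eval fun _ => 1) := by
  have h1 : selectMatrix k (targetFace ht i) *
      (Matrix.of fun (s : {s // t s = i}) (s' : {s // t s + 1 = i + 1}) =>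
        if s.1 = s'.1 then (1 : k) else 0) = selectMatrix k (sourceFace ht (i + 1)) := by
    ext A s
    rw [Matrix.mul_apply, Finset.sum_eq_single ⟨s.1, by have := s.2; omega⟩]
    · simp only [Matrix.of_apply, if_true, mul_one]
      rfl
    · intro s' _ hs'
      rw [Matrix.of_apply, if_neg fun h => hs' (Subtype.ext h), mul_zero]
    · simp
  have h2 : ((Matrix.of fun (s : {s // t s = i}) (s' : {s // t s + 1 = i + 1}) =>
        if s.1 = s'.1 then (1 : MvPolynomial (Fin n) k) else 0).map (eval fun _ => 1)) =
      Matrix.of fun s s' => if s.1 = s'.1 then 1 else 0 := by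
    ext s s'
    simp only [Matrix.map_apply, Matrix.of_apply]
    split_ifs <;> simp
  rw [splitMatrix, splitMatrix, splitDifferential, Matrix.fromBlocks_map, Matrix.fromBlocks_map, h2,
    Matrix.fromCols_mul_fromBlocks, Matrix.mul_fromCols, Matrix.mul_fromCols,
    Matrix.fromCols_mul_fromBlocks, ← Matrix.mul_assoc, boundaryMatrix_mul,
    boundaryMatrix_mul_chainMatrix i (hB (i + 1)).boundary_eq]
  simp [Matrix.mul_assoc, h1, BasedSequence.frame]

theorem isTaylorBasis_of_admissible (hF : IsMinimalFreeResolution m F) (hc : c ≠ 0)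
    (hB : ∀ i, IsAdmissibleStep m F c B i) : IsTaylorBasis m F B := by
  obtain ⟨h0, h1, hinj⟩ := graded_quasiIso_of_admissible hF hc hB
  -- The faces in `J i` have reduced boundaries forming a basis of the reduced boundaries in degree
  -- `i`; they generate the trivial summands.
  choose J hJi hJs using fun i => exists_column_basis
    (diagPart (chainDeg m i) (chainDeg m (i + 1)) (boundaryMatrix k r i))
  obtain ⟨q, ⟨e⟩⟩ := Finite.exists_equiv_fin
    {A : Finset (Fin r) // ∃ i, ∃ h : A.card = i + 1, (⟨A, h⟩ : Face r (i + 1)) ∈ J i}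
  let E : Fin q → Finset (Fin r) := fun s => (e.symm s).1
  let t : Fin q → ℕ := fun s => (E s).card - 1
  have ht : ∀ s, (E s).card = t s + 1 := by
    intro s
    obtain ⟨i, h, -⟩ := (e.symm s).2
    have h' : (E s).card = i + 1 := h
    have : 0 < (E s).card := by omega
    exact (Nat.succ_pred_eq_of_pos this).symm
  have hE : Function.Injective E := Subtype.val_injective.comp e.symm.injective
  have hEJ : ∀ i (A : Face r (i + 1)), A ∈ J i ↔ ∃ s, E s = A.1 := by
    intro i A
    constructor
    · intro hA
      exact ⟨e ⟨A.1, i, A.2, hA⟩, by simp [E]⟩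
    · rintro ⟨s, hs⟩
      obtain ⟨i', h, hJ⟩ := (e.symm s).2
      obtain rfl : i' = i := by
        have h1 : (E s).card = i + 1 := hs ▸ A.2
        have h2 : (E s).card = i' + 1 := h
        omega
      have : A = ⟨(e.symm s).1, h⟩ := Subtype.ext hs.symm
      rw [this]
      exact hJ
  have htarget : ∀ i (A : Face r (i + 1)), A ∈ J i ↔ A ∈ Set.range (targetFace ht i) := by
    intro i A
    rw [hEJ]
    constructor
    · rintro ⟨s, hs⟩
      have := ht s
      rw [hs, A.2] at this
      exact ⟨⟨s, by omega⟩, Subtype.ext hs⟩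
    · rintro ⟨s, rfl⟩
      exact ⟨s, rfl⟩
  have hsource : ∀ i (A : Face r (i + 1)), A ∈ J i ↔ A ∈ Set.range (sourceFace ht (i + 1)) := by
    intro i A
    rw [hEJ]
    constructor
    · rintro ⟨s, hs⟩
      have := ht s
      rw [hs, A.2] at this
      exact ⟨⟨s, this.symm⟩, Subtype.ext hs⟩
    · rintro ⟨s, rfl⟩
      exact ⟨s, rfl⟩
  have htinj : ∀ i, Function.Injective (targetFace ht i) := fun i s s' h =>
    Subtype.ext (hE (congrArg (fun A : Face r _ => A.1) h))
  have hsinj : ∀ i, Function.Injective (sourceFace ht i) := fun i s s' h =>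
    Subtype.ext (hE (congrArg (fun A : Face r _ => A.1) h))
  have hPinj : ∀ i w, diagPart (chainDeg m i) (splitDeg m F t E i) (splitMatrix F B ht i) *ᵥ w = 0 →
      w = 0 := by
    intro i w hw
    obtain ⟨x, u, v, rfl⟩ : ∃ x u v, w = Sum.elim x (Sum.elim u v) :=
      ⟨w ∘ Sum.inl, w ∘ Sum.inr ∘ Sum.inl, w ∘ Sum.inr ∘ Sum.inr, by ext (j | j | j) <;> rfl⟩
    rw [diagPart_splitMatrix_mulVec] at hw
    -- Applying the reduced boundary kills the chains of `B`, by minimality, and the boundary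
    -- columns, leaving a relation among independent columns.
    have hv : v = 0 := by
      cases i with
      | zero =>
        ext s
        exact absurd s.2 (Nat.succ_ne_zero _)
      | succ i =>
        refine eq_zero_of_selectMatrix_mulVec (hsinj (i + 1)) ?_
        refine hJi i _ (fun A hA => selectMatrix_mulVec_of_notMem _ (by rwa [← hsource])) ?_
        have h2 := congrArg (fun z => diagPart (chainDeg m i) (chainDeg m (i + 1))
          (boundaryMatrix k r i) *ᵥ z) hw
        simp only [Matrix.mulVec_add, Matrix.mulVec_zero] at h2
        rw [diagPart_mulVec_mulVec (isFiltered_boundaryMatrix m i)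
            (isFiltered_chainMatrix hF hB (i + 1)),
          boundaryMatrix_mul_chainMatrix i (hB (i + 1)).boundary_eq,
          diagPart_mul (b := F.mdeg i) (isFiltered_chainMatrix hF hB i)
            (hF.isComplex.isFiltered_frame i),
          hF.diagPart_frame, Matrix.mul_zero, Matrix.zero_mulVec, zero_add,
          diagPart_mulVec_mulVec (isFiltered_boundaryMatrix m i)
            (isFiltered_boundaryMatrix m (i + 1)),
          boundaryMatrix_mul, diagPart_zero, Matrix.zero_mulVec, zero_add] at h2
        exact h2
    rw [hv, Matrix.mulVec_zero, add_zero] at hw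
    have hx := hinj i _ _ hw
    rw [hx, Matrix.mulVec_zero, zero_add] at hw
    have hu : u = 0 := eq_zero_of_selectMatrix_mulVec (htinj i)
      (hJi i _ (fun A hA => selectMatrix_mulVec_of_notMem _ (by rwa [← htarget])) hw)
    rw [hx, hu, hv]
    ext (j | j | j) <;> rfl
  have hPsurj : ∀ i y, ∃ w,
      diagPart (chainDeg m i) (splitDeg m F t E i) (splitMatrix F B ht i) *ᵥ w = y := by
    intro i y
    -- Subtracting selected faces turns `y` into a reduced cycle, to which surjectivity on homology
    -- applies.
    obtain ⟨v, hv⟩ : ∃ v, ∃ x y', diagPart (chainDeg m i) (F.mdeg i) (chainMatrix F B i) *ᵥ x +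
        diagPart (chainDeg m i) (chainDeg m (i + 1)) (boundaryMatrix k r i) *ᵥ y' =
          y - selectMatrix k (sourceFace ht i) *ᵥ v := by
      cases i with
      | zero =>
        refine ⟨0, ?_⟩
        rw [Matrix.mulVec_zero, sub_zero]
        exact h0 y
      | succ i =>
        obtain ⟨c', hc', hDc'⟩ := hJs i y
        refine ⟨c' ∘ sourceFace ht (i + 1), h1 i _ ?_⟩
        rw [selectMatrix_mulVec_comp (hsinj (i + 1)) (fun A hA => hc' A (by rwa [hsource])),
          Matrix.mulVec_sub, hDc', sub_self]
    obtain ⟨x, y', hxy⟩ := hv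
    obtain ⟨c', hc', hDc'⟩ := hJs i y'
    refine ⟨Sum.elim x (Sum.elim (c' ∘ targetFace ht i) v), ?_⟩
    rw [diagPart_splitMatrix_mulVec,
      selectMatrix_mulVec_comp (htinj i) (fun A hA => hc' A (by rwa [htarget])), hDc', hxy,
      sub_add_cancel]
  have hPfil := isFiltered_splitMatrix (E := E) (t := t) hF hB ht
  choose f hf using fun i => exists_homogenized_basis (hPfil i) (hPinj i) (hPsurj i)
  have hf1 : ∀ i j A, IsMultigradedCoeff (splitDeg m F t E i j) (chainDeg m i A) (f i j A) := by
    intro i j A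
    rw [hf]
    exact isMultigradedCoeff_monomial fun h => hPfil i A j h
  have hf2 : ∀ i j, (taylorResolution k m).mat i *ᵥ f (i + 1) j =
      ∑ l, splitDifferential F t i l j • f i l := by
    intro i j
    have h2 := sum_smul_homogenize (hPfil i)
      (isMultigradedMatrix_splitDifferential (m := m) (E := E) hF.isComplex i) j
    rw [← boundaryMatrix_mul_splitMatrix hB ht] at h2
    have h3 := taylorResolution_mat_mulVec m ((hPfil (i + 1)).supportedBelow_col j)
    simp only [hf]
    exact h3.trans h2.symm
  have hf3 : ∀ i (j : F.ι i) A, B i j A = eval (fun _ => 1) (f i (Sum.inl j) A) := by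
    intro i j A
    rw [hf]
    simp [homogenize, eval_monomial, splitMatrix, chainMatrix]
  exact ⟨q, t, fun s => faceDeg m (E s), f, ⟨hf1, hf2⟩, hf3⟩

end Split

/-! ## Taylor bases are outcomes of the construction -/

section Converse

variable {m : Fin r → (Fin n →₀ ℕ)} {F : BasedSequence k n} {B : ∀ i, F.ι i → Chain k r i}

/-- The matrices of the Taylor resolution. -/
def taylorMatrix (k : Type*) [Field k] {n r : ℕ} (m : Fin r → (Fin n →₀ ℕ)) (i : ℕ) :
    Matrix (Face r i) (Face r (i + 1)) (MvPolynomial (Fin n) k) := (taylorResolution k m).mat i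

lemma taylorMatrix_map (m : Fin r → (Fin n →₀ ℕ)) (i : ℕ) :
    (taylorMatrix k m i).map (eval fun _ => 1) = boundaryMatrix k r i :=
  taylorResolution_mat_map m i

lemma taylorMatrix_mulVec_homogenize {i : ℕ} {α : Fin n →₀ ℕ} {x : Chain k r (i + 1)}
    (hx : SupportedBelow (chainDeg m (i + 1)) α x) :
    taylorMatrix k m i *ᵥ homogenize (chainDeg m (i + 1)) α x =
      homogenize (chainDeg m i) α (boundary x) :=
  taylorResolution_mat_mulVec m hx

/-- The bases `f` split the Taylor resolution into a copy of `F`, which dehomogenizes to `B`, and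
a complementary complex with bases indexed by `K`. -/
structure IsSplitting (m : Fin r → (Fin n →₀ ℕ)) (F : BasedSequence k n)
    (B : ∀ i, F.ι i → Chain k r i) {K : ℕ → Type} [∀ i, Fintype (K i)]
    (f : ∀ i, Module.Basis (F.ι i ⊕ K i) (MvPolynomial (Fin n) k)
      (Face r i → MvPolynomial (Fin n) k)) : Prop where
  multigraded : ∀ i j A, IsMultigradedCoeff (F.mdeg i j) (chainDeg m i A) (f i (Sum.inl j) A)
  mulVec_inl : ∀ i j, taylorMatrix k m i *ᵥ f (i + 1) (Sum.inl j) =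
    ∑ l, F.mat i l j • f i (Sum.inl l)
  mulVec_inr : ∀ i s, ∃ w : K i → MvPolynomial (Fin n) k,
    taylorMatrix k m i *ᵥ f (i + 1) (Sum.inr s) = ∑ l, w l • f i (Sum.inr l)
  eval_eq : ∀ i j A, B i j A = eval (fun _ => 1) (f i (Sum.inl j) A)

lemma IsTaylorBasis.exists_isSplitting (h : IsTaylorBasis m F B) :
    ∃ (K : ℕ → Type) (_ : ∀ i, Fintype (K i))
      (f : ∀ i, Module.Basis (F.ι i ⊕ K i) (MvPolynomial (Fin n) k)
        (Face r i → MvPolynomial (Fin n) k)), IsSplitting m F B f := by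
  obtain ⟨q, t, a, f, ⟨hf1, hf2⟩, hB⟩ := h
  refine ⟨(BasedSequence.trivialComplex k q t a).ι, inferInstance, f,
    fun i j A => hf1 i (Sum.inl j) A, fun i j => ?_, fun i s => ?_, hB⟩
  · refine (hf2 i (Sum.inl j)).trans ((Fintype.sum_sum_type _).trans (add_eq_left.2 ?_))
    exact Finset.sum_eq_zero fun l _ => zero_smul _ _
  · refine ⟨fun l => (BasedSequence.trivialComplex k q t a).mat i l s, ?_⟩
    refine (hf2 i (Sum.inr s)).trans ((Fintype.sum_sum_type _).trans (add_eq_right.2 ?_))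
    exact Finset.sum_eq_zero fun l _ => zero_smul _ _

lemma homogenize_sub {ι : Type*} (deg : ι → (Fin n →₀ ℕ)) (α : Fin n →₀ ℕ) (x y : ι → k) :
    homogenize deg α (x - y) = homogenize deg α x - homogenize deg α y := by
  ext1 j
  simp [homogenize]

lemma homogenize_of_le {ι : Type*} {deg : ι → (Fin n →₀ ℕ)} {α β : Fin n →₀ ℕ} {x : ι → k}
    (hx : SupportedBelow deg α x) (h : α ≤ β) :
    homogenize deg β x = monomial (β - α) (1 : k) • homogenize deg α x := by
  ext1 j
  simp only [homogenize, Pi.smul_apply, smul_eq_mul, monomial_mul, one_mul]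
  by_cases h0 : x j = 0
  · simp [h0]
  · rw [tsub_add_tsub_cancel h (hx j h0)]

namespace IsSplitting

variable {K : ℕ → Type} [∀ i, Fintype (K i)]
  {f : ∀ i, Module.Basis (F.ι i ⊕ K i) (MvPolynomial (Fin n) k)
    (Face r i → MvPolynomial (Fin n) k)}

lemma supportedBelow (hf : IsSplitting m F B f) (i : ℕ) (j : F.ι i) :
    SupportedBelow (chainDeg m i) (F.mdeg i j) (B i j) := by
  refine fun A hA => (hf.multigraded i j A).le fun h0 => hA ?_
  rw [hf.eval_eq, h0, map_zero]

lemma basis_eq_homogenize (hf : IsSplitting m F B f) (i : ℕ) (j : F.ι i) :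
    f i (Sum.inl j) = homogenize (chainDeg m i) (F.mdeg i j) (B i j) := by
  ext1 A
  rw [homogenize, hf.eval_eq]
  exact (hf.multigraded i j A).eq_monomial

lemma boundary_eq (hf : IsSplitting m F B f) (i : ℕ) (j : F.ι (i + 1)) :
    boundary (B (i + 1) j) = frameCycle F B i j := by
  ext A
  have h1 := congrArg (eval fun _ => (1 : k)) (congrFun (hf.mulVec_inl i j) A)
  have h2 : (fun A => eval (fun _ => (1 : k)) (f (i + 1) (Sum.inl j) A)) = B (i + 1) j := by
    ext A
    exact (hf.eval_eq (i + 1) j A).symm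
  have h3 := RingHom.map_mulVec (eval fun _ => (1 : k)) (taylorMatrix k m i)
    (f (i + 1) (Sum.inl j)) A
  rw [taylorMatrix_map] at h3
  rw [← h2]
  refine h3.symm.trans (h1.trans ?_)
  simp only [Finset.sum_apply, Pi.smul_apply, smul_eq_mul, map_sum, map_mul, ← hf.eval_eq,
    frameCycle]
  rfl

/-- In the basis `f`, the coordinates of a boundary at the basis elements of `F` have no constant
term. -/
lemma constantCoeff_repr_mulVec (hF : IsMinimalFreeResolution m F) (hf : IsSplitting m F B f)
    {i : ℕ} (j : F.ι i) (z : Face r (i + 1) → MvPolynomial (Fin n) k) :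
    constantCoeff ((f i).repr (taylorMatrix k m i *ᵥ z) (Sum.inl j)) = 0 := by
  classical
  conv_lhs => rw [← (f (i + 1)).sum_repr z]
  rw [Matrix.mulVec_sum, map_sum, Finsupp.finsetSum_apply, map_sum]
  refine Finset.sum_eq_zero fun g _ => ?_
  rw [Matrix.mulVec_smul, map_smul, Finsupp.smul_apply, smul_eq_mul, map_mul]
  refine mul_eq_zero_of_right _ ?_
  rcases g with g | g
  · rw [hf.mulVec_inl]
    simp [Finsupp.single_apply, hF.minimal i j g]
  · obtain ⟨w, hw⟩ := hf.mulVec_inr i g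
    rw [hw]
    simp

/-- A basis element is not divisible by a nontrivial monomial, even modulo boundaries. -/
lemma le_of_basis_sub_smul_mem (hF : IsMinimalFreeResolution m F) (hf : IsSplitting m F B f)
    {i : ℕ} {j : F.ι i} {α β : Fin n →₀ ℕ} {x : Face r i → MvPolynomial (Fin n) k}
    (z : Face r (i + 1) → MvPolynomial (Fin n) k)
    (h : taylorMatrix k m i *ᵥ z = f i (Sum.inl j) - monomial (β - α) (1 : k) • x) : β ≤ α := by
  have h1 := hf.constantCoeff_repr_mulVec hF j z
  rw [h, map_sub, map_smul, Module.Basis.repr_self, Finsupp.sub_apply, Finsupp.single_eq_same,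
    Finsupp.smul_apply, smul_eq_mul, map_sub, map_mul, map_one, constantCoeff_monomial] at h1
  split_ifs at h1 with h2
  · exact tsub_eq_zero_iff_le.1 h2
  · simp at h1

/-- The differential of a basis element is not a boundary in a smaller degree. -/
lemma mdeg_le_of_boundary_eq (hF : IsMinimalFreeResolution m F) (hf : IsSplitting m F B f)
    {i : ℕ} {j : F.ι (i + 1)} {α : Fin n →₀ ℕ} {x : Chain k r (i + 1)}
    (hx : SupportedBelow (chainDeg m (i + 1)) α x) (hα : α ≤ F.mdeg (i + 1) j)
    (h : boundary x = boundary (B (i + 1) j)) : F.mdeg (i + 1) j ≤ α := by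
  obtain ⟨y, hy, hyx⟩ := exists_boundary_eq_of_supportedBelow (B (i + 1) j - x)
    ((hf.supportedBelow (i + 1) j).sub (hx.mono hα))
    ((Matrix.mulVec_sub (boundaryMatrix k r i) (B (i + 1) j) x).trans (sub_eq_zero.2 h.symm))
  have h3 := taylorMatrix_mulVec_homogenize hy
  rw [hyx, homogenize_sub, ← hf.basis_eq_homogenize, homogenize_of_le hx hα] at h3
  exact hf.le_of_basis_sub_smul_mem hF _ h3

/-- Minimality of the generating set leaves only one vertex whose generator divides `m v`. -/
lemma exists_degree_one (hm : ∀ u v, m u ≤ m v → u = v) (hF : IsMinimalFreeResolution m F)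
    (hf : IsSplitting m F B f) (j : F.ι 1) :
    ∃ v, F.mdeg 1 j = m v ∧ ∃ b : k, B 1 j = b • Pi.single (vertexFace v) 1 := by
  classical
  obtain ⟨v, hv⟩ := hF.exists_mdeg_one_eq j
  refine ⟨v, hv, B 1 j (vertexFace v), ?_⟩
  ext A
  obtain ⟨w, rfl⟩ := exists_eq_vertexFace A
  by_cases hwv : w = v
  · subst hwv
    simp
  · have h1 : B 1 j (vertexFace w) = 0 := by
      by_contra h0
      have h2 := hf.supportedBelow 1 j _ h0
      rw [chainDeg_vertexFace, hv] at h2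
      exact hwv (hm _ _ h2)
    have h2 : vertexFace w ≠ vertexFace v := fun h =>
      hwv (Finset.singleton_injective (congrArg Subtype.val h))
    simp [h1, h2]

lemma supp_subset_vertexClosure (hF : IsMinimalFreeResolution m F) (hf : IsSplitting m F B f)
    (i : ℕ) (j : F.ι (i + 2)) :
    (B (i + 2) j).supp ⊆ vertexClosure m (frameSupport F B (i + 1) j) := by
  intro v hv
  simp only [vertexClosure, Finset.mem_filter, Finset.mem_univ, true_and]
  intro α _ hα
  -- The meet is needed because `α` may be incomparable to the degree of `j`, and the comparison of
  -- fillings takes place in the strand of that degree.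
  have hcycle : SupportedBelow (chainDeg m (i + 1)) (α ⊓ F.mdeg (i + 2) j)
      (boundary (B (i + 2) j)) := by
    intro A hA
    refine le_inf ?_ ((isFiltered_boundaryMatrix m (i + 1)).mulVec (hf.supportedBelow (i + 2) j)
      A hA)
    rw [hf.boundary_eq] at hA
    rw [faceDeg_le_iff]
    exact (Chain.subset_supp hA).trans ((frameCycle_supp_subset _ j).trans hα)
  obtain ⟨x, hx, hx'⟩ := exists_boundary_eq_of_supportedBelow _ hcycle (boundary_boundary _)
  have h1 := (hf.mdeg_le_of_boundary_eq hF hx inf_le_right hx').trans inf_le_left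
  exact supportedBelow_chainDeg_iff.1 ((hf.supportedBelow (i + 2) j).mono h1) hv

end IsSplitting

theorem exists_admissible_of_isTaylorBasis (hm : ∀ u v, m u ≤ m v → u = v)
    (hF : IsMinimalFreeResolution m F) (h : IsTaylorBasis m F B) :
    ∃ c : k, c ≠ 0 ∧ ∀ i, IsAdmissibleStep m F c B i := by
  obtain ⟨K, _, f, hf⟩ := h.exists_isSplitting
  have hone : ∀ j : F.ι 1, (∃ v, F.mdeg 1 j = m v ∧ ∃ b : k,
      B 1 j = b • Pi.single (vertexFace v) 1) ∧ boundary (B 1 j) = frameCycle F B 0 j :=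
    fun j => ⟨hf.exists_degree_one hm hF j, hf.boundary_eq 0 j⟩
  have htwo : ∀ i (j : F.ι (i + 2)), boundary (B (i + 2) j) = frameCycle F B (i + 1) j ∧
      (B (i + 2) j).supp ⊆ vertexClosure m (frameSupport F B (i + 1) j) :=
    fun i j => ⟨hf.boundary_eq (i + 1) j, hf.supp_subset_vertexClosure hF i j⟩
  obtain ⟨hempty, -⟩ | ⟨j₀, huniq, -⟩ := hF.degree_zero
  · refine ⟨1, one_ne_zero, ?_⟩
    rintro (_ | _ | i)
    · exact fun j => (hempty.false j).elim
    · exact hone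
    · exact htwo i
  -- The scalar is the coefficient of `∅`, nonzero because a basis element is nonzero.
  · refine ⟨B 0 j₀ ⟨∅, rfl⟩, ?_, ?_⟩
    · intro h0
      have h1 : B 0 j₀ = 0 := by
        ext A
        have : A = ⟨∅, rfl⟩ := Subtype.ext (face_zero_val A)
        rw [this, h0]
        rfl
      have h2 := hf.basis_eq_homogenize 0 j₀
      rw [h1, homogenize_zero] at h2
      exact (f 0).ne_zero _ h2
    · rintro (_ | _ | i)
      · intro j
        obtain rfl := huniq j
        ext A
        congr 1
        exact Subtype.ext (face_zero_val A)
      · exact hone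
      · exact htwo i

end Converse

end

theorem mainTheorem7 {k : Type*} [Field k] {n r : ℕ} (m : Fin r → (Fin n →₀ ℕ))
    (hm : ∀ u v, m u ≤ m v → u = v) (F : BasedSequence k n)
    (hF : IsMinimalFreeResolution m F) :
    -- the construction never gets stuck: every admissible beginning can be completed
    (∀ c : k, c ≠ 0 → ∀ (N : ℕ) (B : ∀ i, F.ι i → Chain k r i),
      (∀ i < N, IsAdmissibleStep m F c B i) →
        ∃ B' : ∀ i, F.ι i → Chain k r i,
          (∀ i < N, B' i = B i) ∧ ∀ i, IsAdmissibleStep m F c B' i) ∧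
    -- every outcome of the construction is a Taylor basis
    (∀ c : k, c ≠ 0 → ∀ B : ∀ i, F.ι i → Chain k r i,
      (∀ i, IsAdmissibleStep m F c B i) → IsTaylorBasis m F B) ∧
    -- every Taylor basis is an outcome of the construction
    (∀ B : ∀ i, F.ι i → Chain k r i, IsTaylorBasis m F B →
      ∃ c : k, c ≠ 0 ∧ ∀ i, IsAdmissibleStep m F c B i) :=
  ⟨fun _ _ N _ hB => exists_admissible_completion hF N hB,
    fun _ hc _ hB => isTaylorBasis_of_admissible hF hc hB,
    fun _ hB => exists_admissible_of_isTaylorBasis hm hF hB⟩
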